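/- Theorem 2.1. Let $p$ be a prime, let $\mathcal{A}(\mathbb{C}_p)$ be the ring of entire functions on $\mathbb{C}_p$, i.e. power series $\sum_{n\ge 0} a_n x^n$ with coefficients in $\mathbb{C}_p$ that converge on all of $\mathbb{C}_p$, and let $\mathcal{M}(\mathbb{C}_p)$ be its field of fractions, the field of meromorphic functions on $\mathbb{C}_p$. A meromorphic function is called rational if it is a quotient of two polynomials, and transcendental otherwise. For $F, f, g \in \mathcal{M}(\mathbb{C}_p)$ we write $F = f \circ g$ if $F(x) = f(g(x))$ in $\mathbb{C}_p \cup \{\infty\}$ for every $x \in \mathbb{C}_p$ that is not a pole of $g$. Let $F \in \mathcal{M}(\mathbb{C}_p)$ be transcendental. Suppose that all but finitely many poles of $F$ are simple, and that for every $\beta \in \mathbb{C}_p$ all but finitely many zeros of $F - \beta$ are simple. Then $F$ is pseudo-prime: for all $f, g \in \mathcal{M}(\mathbb{C}_p)$ with $F = f \circ g$, at least one of $f$ and $g$ is rational. -/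

import Mathlib

open Filter Topology

namespace PadicMero

/-- The algebra of entire functions on `ℂ_p`: power series `∑ aₙ xⁿ` over `ℂ_p` with infinite
radius of convergence, i.e. `|aₙ| rⁿ → 0` for every real `r`. -/
noncomputable def Entire (p : ℕ) [Fact p.Prime] : Subalgebra ℂ_[p] (PowerSeries ℂ_[p]) where
  carrier := {f | ∀ r : ℝ, Tendsto (fun n : ℕ => ‖PowerSeries.coeff n f‖ * r ^ n) atTop (𝓝 0)}
  mul_mem' {a b} ha hb r := (PowerSeries.isRestricted_iff' r (a * b)).1
    (PowerSeries.isRestricted.mul r ((PowerSeries.isRestricted_iff' r a).2 (ha r))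
      ((PowerSeries.isRestricted_iff' r b).2 (hb r)))
  add_mem' {a b} ha hb r := (PowerSeries.isRestricted_iff' r (a + b)).1
    (PowerSeries.isRestricted.add r ((PowerSeries.isRestricted_iff' r a).2 (ha r))
      ((PowerSeries.isRestricted_iff' r b).2 (hb r)))
  algebraMap_mem' c r := (PowerSeries.isRestricted_iff' r _).1 (PowerSeries.isRestricted_C r c)

variable {p : ℕ} [Fact p.Prime]

/-- The value `f(x) = ∑ aₙ xⁿ` of an entire function (the series always converges). -/
noncomputable def Entire.eval (f : Entire p) (x : ℂ_[p]) : ℂ_[p] :=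
  ∑' n : ℕ, PowerSeries.coeff n (f : PowerSeries ℂ_[p]) * x ^ n

theorem polynomial_mem_entire (P : Polynomial ℂ_[p]) :
    (P : PowerSeries ℂ_[p]) ∈ Entire p := by
  intro r
  refine tendsto_const_nhds.congr' ?_
  filter_upwards [eventually_gt_atTop P.natDegree] with n hn
  simp [Polynomial.coeff_eq_zero_of_natDegree_lt hn]

/-- A polynomial, as an entire function. -/
noncomputable def Entire.ofPolynomial (P : Polynomial ℂ_[p]) : Entire p :=
  ⟨P, polynomial_mem_entire P⟩

variable (p) in
/-- The field of meromorphic functions on `ℂ_p`: the field of fractions of the ring of entire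
functions. -/
def Mero : Type := FractionRing (Entire p)

noncomputable instance : Field (Mero p) := inferInstanceAs (Field (FractionRing (Entire p)))

noncomputable instance : Algebra (Entire p) (Mero p) :=
  inferInstanceAs (Algebra (Entire p) (FractionRing (Entire p)))

instance : IsFractionRing (Entire p) (Mero p) :=
  inferInstanceAs (IsFractionRing (Entire p) (FractionRing (Entire p)))

/-- Constants as meromorphic functions. -/
noncomputable instance : Algebra ℂ_[p] (Mero p) :=
  inferInstanceAs (Algebra ℂ_[p] (FractionRing (Entire p)))

instance : IsScalarTower ℂ_[p] (Entire p) (Mero p) :=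
  IsScalarTower.of_algebraMap_eq fun _ => rfl

namespace Mero

/-- A meromorphic function is rational if it is a quotient of two polynomials. -/
def IsRational (h : Mero p) : Prop :=
  ∃ P Q : Polynomial ℂ_[p], Q ≠ 0 ∧
    h = algebraMap (Entire p) (Mero p) (Entire.ofPolynomial P) /
      algebraMap (Entire p) (Mero p) (Entire.ofPolynomial Q)

/-- A meromorphic function is transcendental if it is not rational. -/
def IsTranscendental (h : Mero p) : Prop := ¬ IsRational h

/-- `h` takes the finite value `c` at `x`: `h = u / v` with `u`, `v` entire, `v(x) ≠ 0` and
`u(x) / v(x) = c`. -/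
def HasValueAt (h : Mero p) (x c : ℂ_[p]) : Prop :=
  ∃ u v : Entire p, Entire.eval v x ≠ 0 ∧
    h = algebraMap (Entire p) (Mero p) u / algebraMap (Entire p) (Mero p) v ∧
    Entire.eval u x / Entire.eval v x = c

open Classical in
/-- The value of a meromorphic function at a point of `ℂ_p`, in `ℂ_p ∪ {∞}`; it is `∞` exactly
at the points where `h` takes no finite value. -/
noncomputable def value (h : Mero p) (x : ℂ_[p]) : OnePoint ℂ_[p] :=
  if H : ∃ c : ℂ_[p], HasValueAt h x c then (H.choose : OnePoint ℂ_[p]) else OnePoint.infty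

/-- The order of a meromorphic function at `x`: `m > 0` at a zero of multiplicity `m`, `-m < 0` at
a pole of multiplicity `m`, and `⊤` if `h = 0`. The number `0` put in for the value `∞` at
the poles is immaterial, as the order only depends on the values at points near `x` other than
`x` itself. -/
noncomputable def order (h : Mero p) (x : ℂ_[p]) : WithTop ℤ :=
  meromorphicOrderAt (fun z : ℂ_[p] => (value h z).elim 0 id) x

/-- `x` is a zero of `h`. -/
def IsZero (h : Mero p) (x : ℂ_[p]) : Prop := 0 < order h x

/-- `x` is a simple zero of `h`. -/
def IsSimpleZero (h : Mero p) (x : ℂ_[p]) : Prop := order h x = 1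

/-- `x` is a pole of `h`. -/
def IsPole (h : Mero p) (x : ℂ_[p]) : Prop := order h x < 0

/-- `x` is a simple pole of `h`. -/
def IsSimplePole (h : Mero p) (x : ℂ_[p]) : Prop := order h x = -1

/-- `F = f ∘ g`: at every point `x` where `g` takes a finite value, `F(x) = f(g(x))`
in `ℂ_p ∪ {∞}`. Nothing is required at the poles of `g`, where `f(∞)` may fail to make sense;
they form a discrete set, so `F` is determined by `f` and `g`. -/
def IsComp (F f g : Mero p) : Prop :=
  ∀ x b : ℂ_[p], value g x = (b : OnePoint ℂ_[p]) → value F x = value f b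

/-- `F` is pseudo-prime: in every factorization `F = f ∘ g` into meromorphic functions,
`f` or `g` is rational. -/
def IsPseudoPrime (F : Mero p) : Prop :=
  ∀ f g : Mero p, IsComp F f g → IsRational f ∨ IsRational g

end Mero

end PadicMero

/-! Suppose `F = f ∘ g` with neither factor rational. Then `g` has no pole: near one it takes every
value of large absolute value, at points where `F` has neither zero nor pole. So `f` would have no
zeros or poles outside some disc, and such a function is rational (`isRational_of_forall_value_ne`).
Hence `g` is entire and not a polynomial, and takes every value infinitely often (`infinite_zeros`).
If `f` ramifies at some `b`, each of the infinitely many solutions of `g = b` is a multiple pole of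
`F` or a multiple zero of `F - f(b)`, against the hypotheses.

It remains to see that an unramified `f` is rational (`exists_polynomial_of_unramified`). Its
Schwarzian derivative has no poles. As integers have norm at most 1, differentiation divides the
Gauss norm at radius `r` by at least `r`; so twice the Schwarzian has Gauss norm at most `1 / r ^ 2`
for every `r`, and vanishes. In characteristic zero a vanishing Schwarzian makes `f` a quotient of
polynomials (`exists_polynomial_of_powerSeries`).

The analytic input is the ultrametric theory of zeros: Gauss norms are multiplicative, and the last
index of a maximal term counts the zeros in the closed disc. This yields zeros (`exists_zero`) and
turns divisibility at every point into divisibility of entire functions (`LocallyDvd.dvd`). -/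

namespace PowerSeries

/-! ### Gauss norms and dominant indices of power series -/

section Dominance

variable {K : Type*} [NormedField K]

/-- `N` is the last index at which `‖aₙ‖ rⁿ` attains its maximum. -/
def DominantAt (f : PowerSeries K) (r : ℝ) (N : ℕ) : Prop :=
  (∀ n, ‖coeff n f‖ * r ^ n ≤ ‖coeff N f‖ * r ^ N) ∧
    ∀ n, N < n → ‖coeff n f‖ * r ^ n < ‖coeff N f‖ * r ^ N

/-- The terms `‖aₙ‖ rⁿ` are bounded by `M`. -/
def BoundedAt (f : PowerSeries K) (r M : ℝ) : Prop := ∀ n, ‖coeff n f‖ * r ^ n ≤ M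

variable {f g : PowerSeries K} {r : ℝ} {N M : ℕ}

theorem DominantAt.pos (hr : 0 < r) (h : DominantAt f r N) : 0 < ‖coeff N f‖ * r ^ N :=
  lt_of_le_of_lt (by positivity) (h.2 (N + 1) (Nat.lt_succ_self N))

theorem DominantAt.unique (h : DominantAt f r N) (h' : DominantAt f r M) : N = M := by
  rcases lt_trichotomy N M with hl | hl | hl
  · exact absurd (h.2 M hl) (not_lt.2 (h'.1 N))
  · exact hl
  · exact absurd (h'.2 N hl) (not_lt.2 (h.1 M))

theorem DominantAt.ne_zero (hr : 0 < r) (h : DominantAt f r N) : f ≠ 0 := by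
  rintro rfl
  simpa using h.pos hr

theorem exists_dominantAt (hr : 0 < r) (hf : f ≠ 0)
    (ht : Tendsto (fun n => ‖coeff n f‖ * r ^ n) atTop (𝓝 0)) : ∃ N, DominantAt f r N := by
  obtain ⟨k, hk⟩ := exists_coeff_ne_zero_iff_ne_zero.2 hf
  have hpos : 0 < ‖coeff k f‖ * r ^ k := by have := norm_pos_iff.2 hk; positivity
  obtain ⟨B, hB⟩ := eventually_atTop.1 (ht.eventually (gt_mem_nhds hpos))
  obtain ⟨m, -, hm⟩ := Finset.exists_max_image (Finset.range (B + k + 1))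
    (fun n => ‖coeff n f‖ * r ^ n) ⟨0, by simp⟩
  have hmax : ∀ n, ‖coeff n f‖ * r ^ n ≤ ‖coeff m f‖ * r ^ m := by
    intro n
    by_cases hn : n < B + k + 1
    · exact hm n (by simpa using hn)
    · exact (hB n (by omega)).le.trans (hm k (by simp))
  have hfin : {n | ‖coeff n f‖ * r ^ n = ‖coeff m f‖ * r ^ m}.Finite := by
    refine (Set.finite_lt_nat B).subset fun n hn => ?_
    by_contra hBn
    have h1 := hB n (not_lt.1 hBn)
    rw [show ‖coeff n f‖ * r ^ n = _ from hn] at h1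
    exact absurd (hmax k) (not_le.2 h1)
  obtain ⟨N, hN, hNmax⟩ := Set.exists_max_image _ id hfin ⟨m, rfl⟩
  have hN : ‖coeff N f‖ * r ^ N = ‖coeff m f‖ * r ^ m := hN
  refine ⟨N, fun n => hN ▸ hmax n, fun n hn => lt_of_le_of_ne (hN ▸ hmax n) fun he => ?_⟩
  exact absurd (hNmax n (he.trans hN)) (not_le.2 hn)

theorem BoundedAt.neg {A : ℝ} (hf : BoundedAt f r A) : BoundedAt (-f) r A := by
  intro n; simpa using hf n

theorem BoundedAt.mono {A B : ℝ} (hf : BoundedAt f r A) (h : A ≤ B) : BoundedAt f r B :=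
  fun n => (hf n).trans h

theorem DominantAt.bounded (h : DominantAt f r N) : BoundedAt f r (‖coeff N f‖ * r ^ N) := h.1

theorem coeff_X_sub_C (z : K) (n : ℕ) : coeff n ((X : PowerSeries K) - C z) =
    if n = 1 then 1 else if n = 0 then -z else 0 := by
  rcases n with _ | _ | n <;> simp [coeff_X]

theorem dominantAt_X_sub_C (hr : 0 < r) {z : K} (hz : ‖z‖ ≤ r) :
    DominantAt ((X : PowerSeries K) - C z) r 1 := by
  refine ⟨fun n => ?_, fun n hn => ?_⟩
  · rcases n with _ | _ | n <;> simp [coeff_X_sub_C, hz, hr.le]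
  · rcases n with _ | _ | n
    · omega
    · omega
    · simp [coeff_X_sub_C, hr]

theorem dominantAt_X_sub_C_of_lt (hr : 0 < r) {z : K} (hz : r < ‖z‖) :
    DominantAt ((X : PowerSeries K) - C z) r 0 := by
  refine ⟨fun n => ?_, fun n hn => ?_⟩
  · rcases n with _ | _ | n <;> simp [coeff_X_sub_C, hz.le]
  · rcases n with _ | _ | n
    · omega
    · simp [coeff_X_sub_C, hz]
    · simpa [coeff_X_sub_C] using hr.trans hz

variable [IsUltrametricDist K]

theorem norm_coeff_mul_le (hr : 0 < r) (f g : PowerSeries K) (n : ℕ) :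
    ∃ i j, i + j = n ∧ ‖coeff n (f * g)‖ * r ^ n ≤
      (‖coeff i f‖ * r ^ i) * (‖coeff j g‖ * r ^ j) := by
  rw [coeff_mul]
  obtain ⟨⟨i, j⟩, hij, hle⟩ := IsUltrametricDist.exists_norm_finsetSum_le_of_nonempty
    (t := Finset.HasAntidiagonal.antidiagonal n) ⟨(0, n), by simp⟩ (fun x => coeff x.1 f * coeff x.2 g)
  have hij : i + j = n := by simpa using hij
  refine ⟨i, j, hij, ?_⟩
  calc _ ≤ ‖coeff i f * coeff j g‖ * r ^ n := by gcongr
    _ = _ := by rw [norm_mul, ← hij, pow_add]; ring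

theorem BoundedAt.mul (hr : 0 < r) {A B : ℝ} (hf : BoundedAt f r A) (hg : BoundedAt g r B) :
    BoundedAt (f * g) r (A * B) := by
  intro n
  obtain ⟨i, j, -, h⟩ := norm_coeff_mul_le hr f g n
  have : 0 ≤ A := le_trans (by positivity) (hf 0)
  exact h.trans (mul_le_mul (hf i) (hg j) (by positivity) this)

theorem BoundedAt.add (hr : 0 < r) {A B : ℝ} (hf : BoundedAt f r A) (hg : BoundedAt g r B) :
    BoundedAt (f + g) r (max A B) := by
  intro n
  rw [map_add]
  have h := IsUltrametricDist.norm_add_le_max (coeff n f) (coeff n g)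
  calc _ ≤ max ‖coeff n f‖ ‖coeff n g‖ * r ^ n := by gcongr
    _ = max (‖coeff n f‖ * r ^ n) (‖coeff n g‖ * r ^ n) := max_mul_of_nonneg _ _ (by positivity)
    _ ≤ _ := max_le_max (hf n) (hg n)

theorem BoundedAt.sub (hr : 0 < r) {A B : ℝ} (hf : BoundedAt f r A) (hg : BoundedAt g r B) :
    BoundedAt (f - g) r (max A B) := sub_eq_add_neg f g ▸ hf.add hr hg.neg

/-- Integers have norm at most 1 in an ultrametric field, so only the shift of index matters. This
bound drives the vanishing of the Schwarzian. -/
theorem BoundedAt.derivative (hr : 0 < r) {A : ℝ} (hf : BoundedAt f r A) :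
    BoundedAt (derivative K f) r (A / r) := by
  intro n
  rw [coeff_derivative, le_div_iff₀ hr, norm_mul]
  have h1 : ‖((n : K) + 1)‖ ≤ 1 := by
    exact_mod_cast IsUltrametricDist.norm_natCast_le_one K (n + 1)
  calc _ ≤ ‖coeff (n + 1) f‖ * 1 * r ^ n * r := by gcongr
    _ = ‖coeff (n + 1) f‖ * r ^ (n + 1) := by ring
    _ ≤ A := hf _

/-- Any other pair of indices with sum `N + M` has `i > N` or `j > M`, so the product of the two
dominant terms strictly exceeds the rest and nothing cancels it. -/
theorem DominantAt.mul_and_norm_coeff_mul (hr : 0 < r) (hf : DominantAt f r N) (hg : DominantAt g r M) :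
    DominantAt (f * g) r (N + M) ∧ ‖coeff (N + M) (f * g)‖ * r ^ (N + M) =
      (‖coeff N f‖ * r ^ N) * (‖coeff M g‖ * r ^ M) := by
  have hlt : ∀ i j, N < i ∨ M < j → (‖coeff i f‖ * r ^ i) * (‖coeff j g‖ * r ^ j) <
      (‖coeff N f‖ * r ^ N) * (‖coeff M g‖ * r ^ M) := by
    rintro i j (h | h)
    · exact (mul_le_mul_of_nonneg_left (hg.1 j)
        (by positivity)).trans_lt (mul_lt_mul_of_pos_right (hf.2 i h) (hg.pos hr))
    · exact (mul_le_mul_of_nonneg_right (hf.1 i) (by positivity)).trans_lt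
        (mul_lt_mul_of_pos_left (hg.2 j h) (hf.pos hr))
  have hval : ‖coeff (N + M) (f * g)‖ * r ^ (N + M) =
      (‖coeff N f‖ * r ^ N) * (‖coeff M g‖ * r ^ M) := by
    have hpos := mul_pos (hf.pos hr) (hg.pos hr)
    have hrn : 0 < r ^ (N + M) := by positivity
    rw [coeff_mul, ← Finset.add_sum_erase _ _ (show (N, M) ∈ Finset.HasAntidiagonal.antidiagonal (N + M) by simp)]
    have hs : ‖∑ x ∈ (Finset.HasAntidiagonal.antidiagonal (N + M)).erase (N, M), coeff x.1 f * coeff x.2 g‖ <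
        ‖coeff N f * coeff M g‖ := by
      rcases ((Finset.HasAntidiagonal.antidiagonal (N + M)).erase (N, M)).eq_empty_or_nonempty with he | hne
      · rw [he, Finset.sum_empty, norm_zero, norm_mul]
        by_contra hcon
        have : ‖coeff N f‖ * ‖coeff M g‖ = 0 := le_antisymm (not_lt.1 hcon) (by positivity)
        rw [show (‖coeff N f‖ * r ^ N) * (‖coeff M g‖ * r ^ M) =
          (‖coeff N f‖ * ‖coeff M g‖) * (r ^ N * r ^ M) by ring, this] at hpos
        simp at hpos
      · obtain ⟨⟨i, j⟩, hij, hle⟩ := IsUltrametricDist.exists_norm_finsetSum_le_of_nonempty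
          hne (fun x => coeff x.1 f * coeff x.2 g)
        simp only [Finset.mem_erase, Finset.HasAntidiagonal.mem_antidiagonal, ne_eq, Prod.mk.injEq] at hij
        have := hlt i j (by omega)
        refine hle.trans_lt (lt_of_mul_lt_mul_right ?_ hrn.le)
        rw [norm_mul, norm_mul, pow_add]
        calc _ = (‖coeff i f‖ * r ^ i) * (‖coeff j g‖ * r ^ j) := by
              rw [← pow_add, ← hij.2, pow_add]; ring
          _ < _ := this
          _ = _ := by ring
    rw [IsUltrametricDist.norm_add_eq_max_of_norm_ne_norm hs.ne', max_eq_left hs.le, norm_mul,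
      pow_add]
    ring
  refine ⟨⟨fun n => ?_, fun n hn => ?_⟩, hval⟩
  · rw [hval]; exact hf.bounded.mul hr hg.bounded n
  · rw [hval]
    obtain ⟨i, j, hij, h⟩ := norm_coeff_mul_le hr f g n
    exact h.trans_lt (hlt i j (by omega))

theorem DominantAt.mul (hr : 0 < r) (hf : DominantAt f r N) (hg : DominantAt g r M) :
    DominantAt (f * g) r (N + M) := (hf.mul_and_norm_coeff_mul hr hg).1

theorem DominantAt.norm_coeff_mul (hr : 0 < r) (hf : DominantAt f r N) (hg : DominantAt g r M) :
    ‖coeff (N + M) (f * g)‖ * r ^ (N + M) =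
      (‖coeff N f‖ * r ^ N) * (‖coeff M g‖ * r ^ M) := (hf.mul_and_norm_coeff_mul hr hg).2

end Dominance

end PowerSeries

/-! ### Roots of polynomials near approximate roots -/

namespace Polynomial

open PowerSeries (DominantAt)

variable {K : Type*} [NormedField K] [IsUltrametricDist K] [IsAlgClosed K] {r : ℝ}

/-- Split into linear factors. A root in the disc raises the dominant index by one and costs a
factor at least `δ / r` against the Gauss norm; a root `w` outside has `‖z - w‖ = ‖w‖` and costs
nothing. -/
theorem le_norm_eval_of_forall_root (hr : 0 < r) {z : K} (hz : ‖z‖ ≤ r) {δ : ℝ} (hδ : 0 ≤ δ)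
    (P : Polynomial K) {N : ℕ} (hP : DominantAt (P : PowerSeries K) r N)
    (hroots : ∀ w, P.IsRoot w → ‖w‖ ≤ r → δ ≤ ‖z - w‖) :
    ‖P.coeff N‖ * r ^ N * (δ / r) ^ N ≤ ‖P.eval z‖ := by
  induction hd : P.natDegree generalizing P N with
  | zero =>
    obtain ⟨c, rfl⟩ := natDegree_eq_zero.1 hd
    have hpos := hP.pos hr
    rw [Polynomial.coeff_coe, coeff_C] at hpos
    obtain rfl : N = 0 := by
      by_contra h
      simp [h] at hpos
    simp
  | succ d ih =>
    obtain ⟨w, hw⟩ := IsAlgClosed.exists_root P (by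
      intro h
      simp [natDegree_eq_of_degree_eq_some h] at hd)
    obtain ⟨Q, rfl⟩ := dvd_iff_isRoot.2 hw
    have hP0 : ((X - C w) * Q) ≠ 0 := by rintro h; rw [h] at hd; simp at hd
    have hQ0 : Q ≠ 0 := right_ne_zero_of_mul hP0
    have hQd : Q.natDegree = d := by
      rw [natDegree_mul (X_sub_C_ne_zero w) hQ0, natDegree_X_sub_C] at hd; omega
    obtain ⟨M, hM⟩ := PowerSeries.exists_dominantAt (f := (Q : PowerSeries K)) hr (by simpa) (by
      refine tendsto_const_nhds.congr' ?_
      filter_upwards [Filter.eventually_gt_atTop Q.natDegree] with n hn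
      simp [coeff_eq_zero_of_natDegree_lt hn])
    have hih := ih Q hM (fun x hx => hroots x (by simp [IsRoot, hx.eq_zero])) hQd
    have hmul : (((X - C w) * Q : Polynomial K) : PowerSeries K) =
        (PowerSeries.X - PowerSeries.C w) * (Q : PowerSeries K) := by simp
    have hcoeff : ∀ n, ‖((X - C w) * Q).coeff n‖ =
        ‖PowerSeries.coeff n ((PowerSeries.X - PowerSeries.C w) * (Q : PowerSeries K))‖ := by
      intro n; rw [← hmul, Polynomial.coeff_coe]
    rw [hmul] at hP
    rw [hcoeff, eval_mul, norm_mul]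
    rcases le_or_gt ‖w‖ r with hwr | hwr
    · have hX := PowerSeries.dominantAt_X_sub_C hr hwr
      obtain rfl := hP.unique (hX.mul hr hM)
      rw [hX.norm_coeff_mul hr hM, PowerSeries.coeff_X_sub_C]
      have hzw := hroots w (by simp [IsRoot]) hwr
      calc _ = δ * (‖Q.coeff M‖ * r ^ M * (δ / r) ^ M) := by
            simp only [if_true, norm_one, Polynomial.coeff_coe, pow_add]; field_simp
        _ ≤ _ := by
          refine mul_le_mul (by simpa using hzw) hih (by positivity) (by positivity)
    · have hX := PowerSeries.dominantAt_X_sub_C_of_lt hr hwr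
      obtain rfl := hP.unique (hX.mul hr hM)
      rw [hX.norm_coeff_mul hr hM, PowerSeries.coeff_X_sub_C]
      have hzw : ‖z - w‖ = ‖w‖ := by
        rw [sub_eq_add_neg, IsUltrametricDist.norm_add_eq_max_of_norm_ne_norm
          (by rw [norm_neg]; exact (hz.trans_lt hwr).ne), norm_neg,
          max_eq_right (hz.trans_lt hwr).le]
      simp only [eval_sub, eval_X, eval_C, hzw]
      calc _ = ‖w‖ * (‖Q.coeff M‖ * r ^ M * (δ / r) ^ M) := by simp; ring
        _ ≤ _ := by gcongr

theorem exists_root_near (hr : 0 < r) {z : K} (hz : ‖z‖ ≤ r) {δ : ℝ} (hδ : 0 ≤ δ)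
    (P : Polynomial K) {N : ℕ} (hP : DominantAt (P : PowerSeries K) r N)
    (h : ‖P.eval z‖ < ‖P.coeff N‖ * r ^ N * (δ / r) ^ N) :
    ∃ w, P.IsRoot w ∧ ‖w‖ ≤ r ∧ ‖z - w‖ < δ := by
  by_contra! hcon
  exact absurd (le_norm_eval_of_forall_root hr hz hδ P hP hcon) (not_le.2 h)

theorem exists_root_of_dominantAt (hr : 0 < r) (P : Polynomial K) {N : ℕ} (hN : N ≠ 0)
    (hP : DominantAt (P : PowerSeries K) r N) : ∃ w, P.IsRoot w ∧ ‖w‖ ≤ r := by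
  have hpos := hP.pos hr
  rw [Polynomial.coeff_coe] at hpos
  -- The position of the root is irrelevant here, so `δ` may be taken as large as needed.
  have ht : Tendsto (fun δ : ℝ => ‖P.coeff N‖ * r ^ N * (δ / r) ^ N) atTop atTop :=
    Tendsto.const_mul_atTop hpos ((tendsto_pow_atTop hN).comp (tendsto_id.atTop_div_const hr))
  obtain ⟨δ, h1, h2⟩ := ((ht.eventually (eventually_gt_atTop ‖P.eval 0‖)).and
    (eventually_ge_atTop 0)).exists
  obtain ⟨w, hw, hwr, -⟩ := exists_root_near hr (z := 0) (by simpa using hr.le) h2 P hP h1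
  exact ⟨w, hw, hwr⟩

end Polynomial

/-! ### Evaluation, translation and division of entire functions -/

namespace PadicMero

variable {p : ℕ} [Fact p.Prime]

namespace Entire

open PowerSeries (DominantAt BoundedAt)

theorem norm_mul_pow_le_geometric {a M r : ℝ} (ha : 0 ≤ a) (n : ℕ)
    (h : a * (2 * (|r| + 1)) ^ n ≤ M) : a * |r| ^ n ≤ M * (1 / 2) ^ n := by
  calc a * |r| ^ n ≤ a * (|r| + 1) ^ n := by gcongr; linarith
    _ = a * (2 * (|r| + 1)) ^ n * (1 / 2) ^ n := by rw [mul_assoc, ← mul_pow]; congr 2; ring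
    _ ≤ _ := by gcongr

/-- A bound at the larger radius `2 * (|r| + 1)` forces geometric decay at `r`. -/
theorem mem_of_bounded {f : PowerSeries ℂ_[p]}
    (h : ∀ r : ℝ, 1 ≤ r → ∃ M, BoundedAt f r M) : f ∈ Entire p := by
  intro r
  obtain ⟨M, hM⟩ := h (2 * (|r| + 1)) (by linarith [abs_nonneg r])
  refine squeeze_zero_norm (a := fun n => M * (1 / 2) ^ n) (fun n => ?_) ?_
  · rw [norm_mul, norm_norm, norm_pow, Real.norm_eq_abs]
    exact norm_mul_pow_le_geometric (norm_nonneg _) n (hM n)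
  · simpa using (tendsto_pow_atTop_nhds_zero_of_lt_one (by norm_num : (0 : ℝ) ≤ 1 / 2)
      (by norm_num)).const_mul M

theorem exists_boundedAt (f : Entire p) (r : ℝ) :
    ∃ M, BoundedAt (f : PowerSeries ℂ_[p]) r M := by
  obtain ⟨M, hM⟩ := (f.2 r).bddAbove_range
  exact ⟨M, fun n => hM ⟨n, rfl⟩⟩

theorem exists_dominantAt {f : Entire p} (hf : f ≠ 0) {r : ℝ} (hr : 0 < r) :
    ∃ N, DominantAt (f : PowerSeries ℂ_[p]) r N :=
  PowerSeries.exists_dominantAt hr (by simpa using hf) (f.2 r)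

theorem summable_norm (f : Entire p) (x : ℂ_[p]) :
    Summable fun n => ‖PowerSeries.coeff n (f : PowerSeries ℂ_[p]) * x ^ n‖ := by
  obtain ⟨M, hM⟩ := exists_boundedAt f (2 * (|‖x‖| + 1))
  refine Summable.of_nonneg_of_le (fun n => norm_nonneg _) (fun n => ?_)
    ((summable_geometric_of_lt_one (by norm_num : (0 : ℝ) ≤ 1 / 2) (by norm_num)).mul_left M)
  rw [norm_mul, norm_pow, ← abs_norm x]
  exact norm_mul_pow_le_geometric (norm_nonneg _) n (hM n)

theorem hasSum_eval (f : Entire p) (x : ℂ_[p]) :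
    HasSum (fun n => PowerSeries.coeff n (f : PowerSeries ℂ_[p]) * x ^ n) (eval f x) :=
  (summable_norm f x).of_norm.hasSum

theorem eval_add (f g : Entire p) (x : ℂ_[p]) : eval (f + g) x = eval f x + eval g x := by
  refine (hasSum_eval (f + g) x).unique ?_
  simpa [add_mul] using (hasSum_eval f x).add (hasSum_eval g x)

theorem eval_mul (f g : Entire p) (x : ℂ_[p]) : eval (f * g) x = eval f x * eval g x := by
  rw [eval, eval, eval, tsum_mul_tsum_eq_tsum_sum_antidiagonal_of_summable_norm
    (summable_norm f x) (summable_norm g x)]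
  refine tsum_congr fun n => ?_
  rw [show ((f * g : Entire p) : PowerSeries ℂ_[p]) = f * g from rfl, PowerSeries.coeff_mul,
    Finset.sum_mul]
  refine Finset.sum_congr rfl fun x hx => ?_
  rw [← Finset.HasAntidiagonal.mem_antidiagonal.1 hx, pow_add]
  ring

theorem eval_ofPolynomial (P : Polynomial ℂ_[p]) (x : ℂ_[p]) :
    eval (ofPolynomial P) x = P.eval x := by
  rw [eval, tsum_eq_sum (s := Finset.range (P.natDegree + 1)), Polynomial.eval_eq_sum_range]
  · simp [ofPolynomial]
  · intro n hn
    simp only [Finset.mem_range, not_lt] at hn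
    simp [ofPolynomial, Polynomial.coeff_eq_zero_of_natDegree_lt (show P.natDegree < n by omega)]

/-- Evaluation at a point, as a ring homomorphism. -/
noncomputable def evalHom (x : ℂ_[p]) : Entire p →+* ℂ_[p] where
  toFun f := eval f x
  map_one' := by
    have := eval_ofPolynomial (p := p) 1 x
    rw [show (ofPolynomial 1 : Entire p) = 1 from Subtype.ext (by simp [ofPolynomial])] at this
    simpa using this
  map_mul' f g := eval_mul f g x
  map_zero' := by simp [eval]
  map_add' f g := eval_add f g x

theorem evalHom_apply (x : ℂ_[p]) (f : Entire p) : evalHom x f = eval f x := rfl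

@[simp] theorem eval_zero (x : ℂ_[p]) : eval (0 : Entire p) x = 0 := map_zero (evalHom x)

@[simp] theorem eval_one (x : ℂ_[p]) : eval (1 : Entire p) x = 1 := map_one (evalHom x)

theorem eval_sub (f g : Entire p) (x : ℂ_[p]) : eval (f - g) x = eval f x - eval g x :=
  map_sub (evalHom x) f g

theorem eval_pow (f : Entire p) (n : ℕ) (x : ℂ_[p]) : eval (f ^ n) x = eval f x ^ n :=
  map_pow (evalHom x) f n

theorem eval_algebraMap (c x : ℂ_[p]) : eval (algebraMap ℂ_[p] (Entire p) c) x = c := by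
  have := eval_ofPolynomial (Polynomial.C c) x
  rwa [show (ofPolynomial (Polynomial.C c) : Entire p) = algebraMap ℂ_[p] (Entire p) c from
    Subtype.ext (by simp [ofPolynomial]), Polynomial.eval_C] at this

/-- Polynomials as entire functions, as a ring homomorphism. -/
noncomputable def ofPolynomialHom : Polynomial ℂ_[p] →+* Entire p where
  toFun := ofPolynomial
  map_one' := Subtype.ext (by simp [ofPolynomial])
  map_mul' _ _ := Subtype.ext (by simp [ofPolynomial])
  map_zero' := Subtype.ext (by simp [ofPolynomial])
  map_add' _ _ := Subtype.ext (by simp [ofPolynomial])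

theorem ofPolynomialHom_apply (P : Polynomial ℂ_[p]) : ofPolynomialHom P = ofPolynomial P := rfl

theorem ofPolynomial_injective : Function.Injective (ofPolynomial : Polynomial ℂ_[p] → Entire p) :=
  fun _ _ h => Polynomial.coe_injective _ (congrArg Subtype.val h)

theorem hasFPowerSeriesOnBall (f : Entire p) : HasFPowerSeriesOnBall (eval f)
    (FormalMultilinearSeries.ofScalars ℂ_[p]
      (fun n => PowerSeries.coeff n (f : PowerSeries ℂ_[p]))) 0 ⊤ := by
  refine ⟨?_, by simp, fun {y} _ => ?_⟩
  · rw [top_le_iff, FormalMultilinearSeries.radius_eq_top_iff_summable_norm]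
    intro r
    have hr : (r : ℝ) = |(r : ℝ)| := (abs_of_nonneg r.2).symm
    obtain ⟨M, hM⟩ := exists_boundedAt f (2 * (|(r : ℝ)| + 1))
    refine Summable.of_nonneg_of_le (fun n => by positivity) (fun n => ?_)
      ((summable_geometric_of_lt_one (by norm_num : (0 : ℝ) ≤ 1 / 2) (by norm_num)).mul_left M)
    rw [FormalMultilinearSeries.norm_apply_eq_norm_coef, FormalMultilinearSeries.coeff_ofScalars, hr]
    exact norm_mul_pow_le_geometric (norm_nonneg _) n (hM n)
  · simp only [zero_add, FormalMultilinearSeries.ofScalars_apply_eq, smul_eq_mul]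
    exact hasSum_eval f y

theorem analyticAt (f : Entire p) (x : ℂ_[p]) : AnalyticAt ℂ_[p] (eval f) x :=
  (hasFPowerSeriesOnBall f).analyticAt_of_mem (by simp)

theorem continuous (f : Entire p) : Continuous (eval f) :=
  continuous_iff_continuousAt.2 fun x => (analyticAt f x).continuousAt

theorem eq_of_eventuallyEq {f g : Entire p} (h : (eval f) =ᶠ[𝓝 0] (eval g)) : f = g := by
  have := (hasFPowerSeriesOnBall f).hasFPowerSeriesAt.eq_formalMultilinearSeries
    ((hasFPowerSeriesOnBall g).hasFPowerSeriesAt.congr h.symm)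
  have := FormalMultilinearSeries.ofScalars_series_injective _ _ this
  exact Subtype.ext (PowerSeries.ext fun n => congrFun this n)

theorem ext_eval {f g : Entire p} (h : ∀ x, eval f x = eval g x) : f = g :=
  eq_of_eventuallyEq (Eventually.of_forall h)

theorem exists_translate (f : Entire p) (x₀ : ℂ_[p]) :
    ∃ g : Entire p, ∀ x, eval g x = eval f (x₀ + x) := by
  have h := (hasFPowerSeriesOnBall f).changeOrigin (y := x₀) (by simp)
  simp only [zero_add, ENNReal.top_sub_coe] at h
  set q := (FormalMultilinearSeries.ofScalars ℂ_[p]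
      (fun n => PowerSeries.coeff n (f : PowerSeries ℂ_[p]))).changeOrigin x₀
  have hq : PowerSeries.mk (fun n => q.coeff n) ∈ Entire p := by
    refine mem_of_bounded fun r hr => ?_
    obtain ⟨M, -, hM⟩ := q.norm_mul_pow_le_of_lt_radius (r := r.toNNReal)
      (lt_of_lt_of_le (by simp) h.r_le)
    refine ⟨M, fun n => ?_⟩
    have := hM n
    rwa [FormalMultilinearSeries.norm_apply_eq_norm_coef, Real.coe_toNNReal _ (by linarith),
      ← PowerSeries.coeff_mk n fun n => q.coeff n] at this
  refine ⟨⟨_, hq⟩, fun x => (hasSum_eval _ x).unique ?_⟩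
  have := h.hasSum (y := x) (by simp)
  simpa [mul_comm] using this

/-- The translate `x ↦ f (x₀ + x)` of an entire function. -/
noncomputable def translate (x₀ : ℂ_[p]) (f : Entire p) : Entire p := (exists_translate f x₀).choose

@[simp] theorem eval_translate (x₀ : ℂ_[p]) (f : Entire p) (x : ℂ_[p]) :
    eval (translate x₀ f) x = eval f (x₀ + x) := (exists_translate f x₀).choose_spec x

theorem translate_mul (x₀ : ℂ_[p]) (f g : Entire p) :
    translate x₀ (f * g) = translate x₀ f * translate x₀ g :=
  ext_eval fun x => by simp [eval_mul]

theorem translate_neg_translate (x₀ : ℂ_[p]) (f : Entire p) :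
    translate (-x₀) (translate x₀ f) = f := ext_eval fun x => by simp

theorem translate_ne_zero (x₀ : ℂ_[p]) {f : Entire p} (hf : f ≠ 0) : translate x₀ f ≠ 0 := by
  intro h
  apply hf
  rw [← translate_neg_translate x₀ f, h]
  exact ext_eval fun x => by simp

theorem translate_ofPolynomial (x₀ : ℂ_[p]) (P : Polynomial ℂ_[p]) :
    translate x₀ (ofPolynomial P) = ofPolynomial (P.comp (Polynomial.C x₀ + Polynomial.X)) :=
  ext_eval fun x => by simp [eval_ofPolynomial]

/-- The entire function `x - z`. -/
noncomputable def xSub (z : ℂ_[p]) : Entire p := ofPolynomial (Polynomial.X - Polynomial.C z)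

theorem coe_xSub (z : ℂ_[p]) :
    (xSub z : PowerSeries ℂ_[p]) = PowerSeries.X - PowerSeries.C z := by
  simp [xSub, ofPolynomial]

@[simp] theorem eval_xSub (z x : ℂ_[p]) : eval (xSub z) x = x - z := by
  simp [xSub, eval_ofPolynomial]

theorem xSub_ne_zero (z : ℂ_[p]) : xSub z ≠ 0 := by
  intro h
  have := eval_xSub z (z + 1)
  rw [h] at this
  simp at this

/-- Synthetic division: the quotient has coefficients `∑ i, a (i + j + 1) * z ^ i`. These tails are
small enough because `f` is bounded at radius `max r ‖z‖`. -/
theorem exists_eq_xSub_mul {f : Entire p} {z : ℂ_[p]} (hz : eval f z = 0) :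
    ∃ q : Entire p, f = xSub z * q := by
  set a : ℕ → ℂ_[p] := fun n => PowerSeries.coeff n (f : PowerSeries ℂ_[p]) with ha
  have hsum : ∀ j, Summable fun i => a (i + j) * z ^ i := by
    intro j
    rcases eq_or_ne z 0 with rfl | hz0
    · refine summable_of_ne_finset_zero (s := {0}) fun i hi => ?_
      simp [show i ≠ 0 by simpa using hi]
    · have := ((summable_nat_add_iff j).2 (hasSum_eval f z).summable).mul_right ((z ^ j)⁻¹)
      refine this.congr fun i => ?_
      rw [pow_add]; field_simp; rfl
  have hrec : ∀ j, ∑' i, a (i + j) * z ^ i = a j + z * ∑' i, a (i + (j + 1)) * z ^ i := by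
    intro j
    rw [(hsum j).tsum_eq_zero_add, ← tsum_mul_left]
    congr 1
    · simp
    · refine tsum_congr fun i => ?_
      rw [show i + 1 + j = i + (j + 1) by ring, pow_succ]; ring
  have hq : PowerSeries.mk (fun j => ∑' i, a (i + (j + 1)) * z ^ i) ∈ Entire p := by
    refine mem_of_bounded fun r hr => ?_
    obtain ⟨M, hM⟩ := exists_boundedAt f (max r ‖z‖)
    refine ⟨M, fun n => ?_⟩
    have hR : 1 ≤ max r ‖z‖ := hr.trans (le_max_left _ _)
    have hR0 : 0 < max r ‖z‖ := by linarith
    rw [PowerSeries.coeff_mk]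
    calc _ ≤ ‖∑' i, a (i + (n + 1)) * z ^ i‖ * max r ‖z‖ ^ n := by gcongr; exact le_max_left _ _
      _ ≤ (M / max r ‖z‖ ^ n) * max r ‖z‖ ^ n := by
        gcongr
        refine IsUltrametricDist.norm_tsum_le_of_forall_le fun i => ?_
        rw [le_div_iff₀ (by positivity), norm_mul, norm_pow]
        calc _ ≤ ‖a (i + (n + 1))‖ * max r ‖z‖ ^ i * max r ‖z‖ ^ n := by
              gcongr; exact le_max_right _ _
          _ = ‖a (i + (n + 1))‖ * max r ‖z‖ ^ (i + n) := by rw [pow_add]; ring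
          _ ≤ ‖a (i + (n + 1))‖ * max r ‖z‖ ^ (i + (n + 1)) := by
            gcongr ‖_‖ * ?_
            exact pow_le_pow_right₀ hR (by omega)
          _ ≤ M := hM _
      _ = M := by field_simp
  refine ⟨⟨_, hq⟩, Subtype.ext (PowerSeries.ext fun n => ?_)⟩
  rw [MulMemClass.coe_mul, coe_xSub, sub_mul, map_sub, PowerSeries.coeff_C_mul, PowerSeries.coeff_mk]
  change a n = _
  rcases n with _ | n
  · have h0 := hrec 0
    rw [show ∑' i, a (i + 0) * z ^ i = 0 from hz] at h0
    rw [PowerSeries.coeff_zero_X_mul]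
    linear_combination h0.symm
  · rw [PowerSeries.coeff_succ_X_mul, PowerSeries.coeff_mk]
    linear_combination -hrec (n + 1)

/-- Truncations keep the dominant index `N`. At a root of one truncation the next takes only its new
top term as value, which tends to zero, so it has a root nearby. Successive differences tend to
zero, which suffices for an ultrametric Cauchy sequence; the limit is a zero of `f`. -/
theorem exists_zero {f : Entire p} {r : ℝ} (hr : 0 < r) {N : ℕ} (hN : N ≠ 0)
    (h : DominantAt (f : PowerSeries ℂ_[p]) r N) : ∃ z, ‖z‖ ≤ r ∧ eval f z = 0 := by
  set F : PowerSeries ℂ_[p] := (f : PowerSeries ℂ_[p]) with hF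
  set ω := ‖PowerSeries.coeff N F‖ * r ^ N with hω
  have hωpos : 0 < ω := h.pos hr
  -- truncations of high order are still dominated at `N`
  set P : ℕ → Polynomial ℂ_[p] := fun n => PowerSeries.trunc (N + n + 1) F with hP
  have hcoef : ∀ n m, (P n).coeff m = if m < N + n + 1 then PowerSeries.coeff m F else 0 :=
    fun n m => PowerSeries.coeff_trunc _ _ _
  have hcN : ∀ n, (P n).coeff N = PowerSeries.coeff N F := fun n => by
    rw [hcoef, if_pos (by omega)]
  have hdom : ∀ n, DominantAt (P n : PowerSeries ℂ_[p]) r N := by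
    intro n
    refine ⟨fun m => ?_, fun m hm => ?_⟩ <;>
      rw [Polynomial.coeff_coe, Polynomial.coeff_coe, hcN, hcoef] <;> split_ifs
    · exact h.1 m
    · simpa using hωpos.le
    · exact h.2 m hm
    · simpa using hωpos
  -- The summand `1 / (n + 1)` keeps `ε n` positive and the later inequality strict when the new
  -- coefficient vanishes. Below, `δ n` solves `ω * (δ n / r) ^ N = ε n`.
  set ε : ℕ → ℝ := fun n => ‖PowerSeries.coeff (N + n + 1) F‖ * r ^ (N + n + 1) + 1 / (n + 1)
    with hε
  have hεpos : ∀ n, 0 < ε n := fun n => by positivity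
  have hεlim : Tendsto ε atTop (𝓝 0) := by
    have h1 := (f.2 r).comp (tendsto_add_atTop_nat (N + 1))
    have h2 := h1.add tendsto_one_div_add_atTop_nhds_zero_nat
    rw [add_zero] at h2
    refine h2.congr fun n => ?_
    simp only [Function.comp_apply, hε, hF]
    rw [show n + (N + 1) = N + n + 1 by ring]
  set δ : ℕ → ℝ := fun n => r * (ε n / ω) ^ (1 / N : ℝ) with hδ
  have hδlim : Tendsto δ atTop (𝓝 0) := by
    have h1 : Tendsto (fun n => ε n / ω) atTop (𝓝 0) := by simpa using hεlim.div_const ω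
    have h2 := (h1.rpow_const (p := (1 / N : ℝ)) (Or.inr (by positivity))).const_mul r
    rwa [Real.zero_rpow (by positivity), mul_zero] at h2
  have hstep : ∀ n (z : ℂ_[p]), (P n).IsRoot z → ‖z‖ ≤ r →
      ∃ w, (P (n + 1)).IsRoot w ∧ ‖w‖ ≤ r ∧ ‖w - z‖ < δ n := by
    intro n z hz hzr
    have hev : (P (n + 1)).eval z = PowerSeries.coeff (N + n + 1) F * z ^ (N + n + 1) := by
      have : P (n + 1) = P n + Polynomial.monomial (N + n + 1) (PowerSeries.coeff (N + n + 1) F) :=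
        PowerSeries.trunc_succ F (N + n + 1)
      rw [this, Polynomial.eval_add, hz.eq_zero, zero_add, Polynomial.eval_monomial]
    obtain ⟨w, hw, hwr, hwz⟩ := Polynomial.exists_root_near hr hzr (δ := δ n)
      (by have := hεpos n; positivity) (P (n + 1)) (hdom (n + 1)) (by
        rw [hcN, hev, norm_mul, norm_pow, ← hω, hδ]
        have h1 : (r * (ε n / ω) ^ (1 / N : ℝ) / r) ^ N = ε n / ω := by
          rw [mul_div_cancel_left₀ _ hr.ne', ← Real.rpow_natCast, ← Real.rpow_mul (by
            have := hεpos n; positivity), one_div_mul_cancel (by exact_mod_cast hN), Real.rpow_one]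
        rw [h1, mul_div_cancel₀ _ hωpos.ne']
        calc _ ≤ ‖PowerSeries.coeff (N + n + 1) F‖ * r ^ (N + n + 1) := by gcongr
          _ < ε n := by simp only [hε]; linarith [show (0 : ℝ) < 1 / (n + 1) by positivity])
    exact ⟨w, hw, hwr, by rwa [norm_sub_rev]⟩
  obtain ⟨z₀, hz₀, hz₀r⟩ := Polynomial.exists_root_of_dominantAt hr (P 0) hN (hdom 0)
  choose! s hs1 hs2 hs3 using hstep
  let z : ℕ → ℂ_[p] := fun n => Nat.rec z₀ (fun n y => s n y) n
  have hz : ∀ n, (P n).IsRoot (z n) ∧ ‖z n‖ ≤ r := by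
    intro n
    induction n with
    | zero => exact ⟨hz₀, hz₀r⟩
    | succ n ih => exact ⟨hs1 n _ ih.1 ih.2, hs2 n _ ih.1 ih.2⟩
  have hcauchy : CauchySeq z := by
    refine NonarchimedeanAddGroup.cauchySeq_of_tendsto_sub_nhds_zero ?_
    refine squeeze_zero_norm (a := δ) (fun n => ?_) hδlim
    exact (hs3 n _ (hz n).1 (hz n).2).le
  obtain ⟨x, hx⟩ := cauchySeq_tendsto_of_complete hcauchy
  refine ⟨x, le_of_tendsto' hx.norm fun n => (hz n).2, ?_⟩
  have h1 : Tendsto (fun n => eval f (z n)) atTop (𝓝 (eval f x)) :=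
    ((continuous f).tendsto x).comp hx
  refine tendsto_nhds_unique h1 ?_
  rw [Metric.tendsto_atTop]
  intro e he
  obtain ⟨B, hB⟩ := eventually_atTop.1 ((f.2 r).eventually (gt_mem_nhds (half_pos he)))
  refine ⟨B, fun n hn => ?_⟩
  rw [dist_zero_right]
  have hsplit := (hasSum_eval f (z n)).summable.sum_add_tsum_nat_add (N + n + 1)
  have hpoly : ∑ i ∈ Finset.range (N + n + 1), PowerSeries.coeff i F * z n ^ i = 0 := by
    rw [← (hz n).1.eq_zero, Polynomial.eval, PowerSeries.eval₂_trunc_eq_sum_range]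
    simp
  rw [show eval f (z n) = ∑' i, PowerSeries.coeff i F * z n ^ i from rfl, ← hsplit, hpoly, zero_add]
  refine lt_of_le_of_lt (IsUltrametricDist.norm_tsum_le_of_forall_le fun i => ?_) (half_lt_self he)
  rw [norm_mul, norm_pow]
  calc _ ≤ ‖PowerSeries.coeff (i + (N + n + 1)) F‖ * r ^ (i + (N + n + 1)) := by
        gcongr; exact (hz n).2
    _ ≤ e / 2 := (hB _ (by omega)).le

end Entire

end PadicMero

/-! ### Factorization and divisibility of entire functions -/

namespace PadicMero

variable {p : ℕ} [Fact p.Prime]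

namespace Entire

open PowerSeries (DominantAt BoundedAt)

/-- The engine of the inductions on the dominant index: removing a zero in the disc lowers the index
by one and divides the Gauss norm by `r`. -/
theorem DominantAt.of_xSub_mul {z : ℂ_[p]} {q : Entire p} {r : ℝ} (hr : 0 < r) (hz : ‖z‖ ≤ r)
    {N : ℕ} (h : DominantAt ((xSub z * q : Entire p) : PowerSeries ℂ_[p]) r N) :
    ∃ M, N = M + 1 ∧ DominantAt (q : PowerSeries ℂ_[p]) r M ∧
      ‖PowerSeries.coeff N ((xSub z * q : Entire p) : PowerSeries ℂ_[p])‖ * r ^ N =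
        r * (‖PowerSeries.coeff M (q : PowerSeries ℂ_[p])‖ * r ^ M) := by
  have hq : q ≠ 0 := by
    rintro rfl
    exact h.ne_zero hr (by simp)
  obtain ⟨M, hM⟩ := exists_dominantAt hq hr
  have hX := PowerSeries.dominantAt_X_sub_C hr hz
  rw [MulMemClass.coe_mul, coe_xSub] at h ⊢
  obtain rfl := h.unique (hX.mul hr hM)
  exact ⟨M, add_comm _ _, hM, by rw [hX.norm_coeff_mul hr hM]; simp [PowerSeries.coeff_X_sub_C]⟩

theorem eval_ne_zero_of_dominantAt_zero {f : Entire p} {r : ℝ} (hr : 0 < r)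
    (h : DominantAt (f : PowerSeries ℂ_[p]) r 0) {z : ℂ_[p]} (hz : ‖z‖ ≤ r) : eval f z ≠ 0 := by
  intro h0
  obtain ⟨q, rfl⟩ := exists_eq_xSub_mul h0
  obtain ⟨M, hM, -⟩ := DominantAt.of_xSub_mul hr hz h
  omega

/-- In a closed disc, an entire function is a polynomial times a function without zeros. -/
theorem exists_eq_ofPolynomial_mul {f : Entire p} (hf : f ≠ 0) {r : ℝ} (hr : 0 < r) :
    ∃ (P : Polynomial ℂ_[p]) (e : Entire p), P ≠ 0 ∧ f = ofPolynomial P * e ∧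
      ∀ z, ‖z‖ ≤ r → eval e z ≠ 0 := by
  obtain ⟨N, hN⟩ := exists_dominantAt hf hr
  induction N generalizing f with
  | zero =>
    refine ⟨1, f, one_ne_zero, ?_, fun z hz => eval_ne_zero_of_dominantAt_zero hr hN hz⟩
    rw [← ofPolynomialHom_apply, map_one, one_mul]
  | succ N ih =>
    obtain ⟨z, hz, hz0⟩ := exists_zero hr (Nat.succ_ne_zero N) hN
    obtain ⟨q, rfl⟩ := exists_eq_xSub_mul hz0
    obtain ⟨M, hM, hq, -⟩ := DominantAt.of_xSub_mul hr hz hN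
    obtain rfl : N = M := by omega
    obtain ⟨P, e, hP, rfl, he⟩ := ih (right_ne_zero_of_mul hf) hq
    refine ⟨(Polynomial.X - Polynomial.C z) * P, e, mul_ne_zero (Polynomial.X_sub_C_ne_zero z) hP,
      ?_, he⟩
    rw [← ofPolynomialHom_apply, ← ofPolynomialHom_apply, map_mul, mul_assoc]
    rfl

/-- Local reduction to lowest terms at `b`. It terminates because each cancellation lowers the
dominant index of `v` on a disc containing `b`. -/
theorem exists_eq_xSub_pow_mul_pair (u : Entire p) {v : Entire p} (hv : v ≠ 0) (b : ℂ_[p]) :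
    ∃ (m : ℕ) (u' v' : Entire p), u = xSub b ^ m * u' ∧ v = xSub b ^ m * v' ∧
      (eval u' b ≠ 0 ∨ eval v' b ≠ 0) := by
  have hr : 0 < ‖b‖ + 1 := by positivity
  obtain ⟨N, hN⟩ := exists_dominantAt hv hr
  induction N generalizing u v with
  | zero =>
    exact ⟨0, u, v, by simp, by simp,
      Or.inr (eval_ne_zero_of_dominantAt_zero hr hN (by linarith))⟩
  | succ N ih =>
    by_cases hb : eval u b ≠ 0 ∨ eval v b ≠ 0
    · exact ⟨0, u, v, by simp, by simp, hb⟩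
    push Not at hb
    obtain ⟨u₁, rfl⟩ := exists_eq_xSub_mul hb.1
    obtain ⟨v₁, rfl⟩ := exists_eq_xSub_mul hb.2
    obtain ⟨M, hM, hq, -⟩ := DominantAt.of_xSub_mul hr (by linarith) hN
    obtain rfl : N = M := by omega
    obtain ⟨m, u', v', rfl, rfl, h⟩ := ih u₁ (right_ne_zero_of_mul hv) hq
    exact ⟨m + 1, u', v', by ring, by ring, h⟩

theorem exists_eq_xSub_pow_mul {f : Entire p} (hf : f ≠ 0) (b : ℂ_[p]) :
    ∃ (m : ℕ) (q : Entire p), f = xSub b ^ m * q ∧ eval q b ≠ 0 := by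
  obtain ⟨m, u', v', rfl, h, hne⟩ := exists_eq_xSub_pow_mul_pair f hf b
  have : u' = v' := mul_left_cancel₀ (pow_ne_zero m (xSub_ne_zero b)) h
  subst this
  exact ⟨m, u', rfl, by simpa using hne⟩

theorem eventually_eval_ne_zero {f : Entire p} (hf : f ≠ 0) (x : ℂ_[p]) :
    ∀ᶠ y in 𝓝[≠] x, eval f y ≠ 0 := by
  obtain ⟨m, q, rfl, hq⟩ := exists_eq_xSub_pow_mul hf x
  have h1 := ((continuous q).continuousAt.eventually_ne hq).filter_mono
    (nhdsWithin_le_nhds (s := {x}ᶜ))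
  filter_upwards [h1, self_mem_nhdsWithin] with y hy hyx
  rw [eval_mul, eval_pow, eval_xSub]
  exact mul_ne_zero (pow_ne_zero _ (sub_ne_zero.2 hyx)) hy

theorem exists_eval_ne_zero {f : Entire p} (hf : f ≠ 0) : ∃ x, eval f x ≠ 0 := by
  by_contra! h
  exact hf (ext_eval fun x => by simp [h x])

/-- With finitely many zeros, all lie in one disc and split off as a polynomial, leaving a cofactor
without zeros. Such a cofactor is constant: otherwise a term of positive degree overtakes the
constant term at a large radius and produces a zero. -/
theorem infinite_zeros {f : Entire p} (hf : ∀ P, f ≠ ofPolynomial P) :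
    {z | eval f z = 0}.Infinite := by
  intro hfin
  obtain ⟨R, hR⟩ := hfin.isBounded.exists_norm_le
  have hr : 0 < max R 1 := by positivity
  have hf0 : f ≠ 0 := fun h => hf 0 (by rw [h, ← ofPolynomialHom_apply, map_zero])
  obtain ⟨P, e, hP, rfl, he⟩ := exists_eq_ofPolynomial_mul hf0 hr
  have he0 : ∀ z, eval e z ≠ 0 := fun z hz =>
    he z ((hR z (by simp [eval_mul, hz])).trans (le_max_left _ _)) hz
  by_cases hconst : ∀ k, k ≠ 0 → PowerSeries.coeff k (e : PowerSeries ℂ_[p]) = 0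
  · refine hf (P * Polynomial.C (PowerSeries.coeff 0 (e : PowerSeries ℂ_[p]))) ?_
    rw [← ofPolynomialHom_apply, ← ofPolynomialHom_apply, map_mul]
    congr 1
    refine Subtype.ext (PowerSeries.ext fun k => ?_)
    rw [ofPolynomialHom_apply]
    rcases eq_or_ne k 0 with rfl | hk
    · simp [ofPolynomial]
    · simp [ofPolynomial, hconst k hk, PowerSeries.coeff_C, hk]
  · push Not at hconst
    obtain ⟨k, hk, hek⟩ := hconst
    set c := PowerSeries.coeff k (e : PowerSeries ℂ_[p])
    have hcpos : 0 < ‖c‖ := norm_pos_iff.2 hek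
    obtain ⟨r, hr1, hr2⟩ := (((tendsto_pow_atTop hk).const_mul_atTop hcpos).eventually
      (eventually_ge_atTop ‖PowerSeries.coeff 0 (e : PowerSeries ℂ_[p])‖)|>.and
      (eventually_gt_atTop 0)).exists
    obtain ⟨N, hN⟩ := exists_dominantAt (right_ne_zero_of_mul hf0) hr2
    have hN0 : N ≠ 0 := by
      rintro rfl
      have := hN.2 k (Nat.pos_of_ne_zero hk)
      simp only [pow_zero, mul_one] at this
      exact absurd hr1 (not_le.2 this)
    obtain ⟨z, -, hz⟩ := exists_zero hr2 hN0 hN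
    exact he0 z hz

/-- `b` divides `a` in the local ring of every point. -/
def LocallyDvd (b a : Entire p) : Prop := ∀ x, ∃ e : Entire p, eval e x ≠ 0 ∧ b ∣ a * e

theorem LocallyDvd.eval_eq_zero {a b : Entire p} (h : LocallyDvd b a) {z : ℂ_[p]}
    (hz : eval b z = 0) : eval a z = 0 := by
  obtain ⟨e, he, c, hc⟩ := h z
  have := congrArg (eval · z) hc
  simp only [eval_mul, hz, zero_mul, mul_eq_zero] at this
  exact this.resolve_right he

theorem LocallyDvd.of_mul {a b c : Entire p} (hc : c ≠ 0) (h : LocallyDvd (c * b) (c * a)) :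
    LocallyDvd b a := fun x => by
  obtain ⟨e, he, d, hd⟩ := h x
  refine ⟨e, he, d, mul_left_cancel₀ hc ?_⟩
  rw [← mul_assoc, hd, mul_assoc]

/-- Cancel the zeros of `b` in the unit disc; what remains has nonzero constant term and is a unit
among formal series. Any positive radius would do. -/
theorem LocallyDvd.exists_powerSeries {a b : Entire p} (hb : b ≠ 0) (h : LocallyDvd b a) :
    ∃ s : PowerSeries ℂ_[p], (a : PowerSeries ℂ_[p]) = s * b := by
  obtain ⟨N, hN⟩ := exists_dominantAt hb one_pos
  induction N generalizing a b with
  | zero =>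
    have h0 : PowerSeries.constantCoeff (b : PowerSeries ℂ_[p]) ≠ 0 := by
      have := hN.pos one_pos
      intro h0
      simp [h0] at this
    exact ⟨a * (b : PowerSeries ℂ_[p])⁻¹, by rw [mul_assoc, PowerSeries.inv_mul_cancel _ h0, mul_one]⟩
  | succ N ih =>
    obtain ⟨z, hz, hz0⟩ := exists_zero one_pos (Nat.succ_ne_zero N) hN
    obtain ⟨a₁, rfl⟩ := exists_eq_xSub_mul (h.eval_eq_zero hz0)
    obtain ⟨b₁, rfl⟩ := exists_eq_xSub_mul hz0
    obtain ⟨M, hM, hq, -⟩ := DominantAt.of_xSub_mul one_pos hz hN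
    obtain rfl : N = M := by omega
    obtain ⟨s, hs⟩ := ih (right_ne_zero_of_mul hb) (h.of_mul (xSub_ne_zero z)) hq
    exact ⟨s, by rw [MulMemClass.coe_mul, MulMemClass.coe_mul, hs]; ring⟩

/-- The Gauss norm of the quotient is at most the quotient of the norms. Cancelling a zero of `b`
divides both norms by `r`. Once the constant term of `b` dominates, solving the product formula for
the coefficients of `s` one by one gives the bound. -/
theorem LocallyDvd.boundedAt {a b : Entire p} (h : LocallyDvd b a)
    {s : PowerSeries ℂ_[p]} (hs : (a : PowerSeries ℂ_[p]) = s * b) {r M : ℝ} (hr : 0 < r) {N : ℕ}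
    (hN : DominantAt (b : PowerSeries ℂ_[p]) r N) (hM : BoundedAt (a : PowerSeries ℂ_[p]) r M) :
    BoundedAt s r (M / (‖PowerSeries.coeff N (b : PowerSeries ℂ_[p])‖ * r ^ N)) := by
  induction N generalizing a b M with
  | zero =>
    set ω := ‖PowerSeries.coeff 0 (b : PowerSeries ℂ_[p])‖ with hω
    have hωpos : 0 < ω := by have := hN.pos hr; rwa [pow_zero, mul_one] at this
    have hM0 : 0 ≤ M := le_trans (by positivity) (hM 0)
    intro n
    rw [pow_zero, mul_one]
    induction n using Nat.strong_induction_on with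
    | _ n ih =>
      have hc := congrArg (PowerSeries.coeff n) hs
      rw [PowerSeries.coeff_mul, ← Finset.add_sum_erase _ _
        (show (n, 0) ∈ Finset.HasAntidiagonal.antidiagonal n by simp)] at hc
      have hc' : PowerSeries.coeff n s * PowerSeries.coeff 0 (b : PowerSeries ℂ_[p]) =
        PowerSeries.coeff n (a : PowerSeries ℂ_[p]) -
          ∑ x ∈ (Finset.HasAntidiagonal.antidiagonal n).erase (n, 0),
            PowerSeries.coeff x.1 s * PowerSeries.coeff x.2 (b : PowerSeries ℂ_[p]) := by
        rw [hc]; ring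
      have hrn : 0 < r ^ n := by positivity
      have hle : ‖PowerSeries.coeff n s * PowerSeries.coeff 0 (b : PowerSeries ℂ_[p])‖ ≤
          M / r ^ n := by
        rw [hc', sub_eq_add_neg]
        refine (IsUltrametricDist.norm_add_le_max _ _).trans (max_le ?_ ?_)
        · rw [le_div_iff₀ hrn]; exact hM n
        · rw [norm_neg]
          refine IsUltrametricDist.norm_sum_le_of_forall_le_of_nonneg (by positivity) ?_
          rintro ⟨i, j⟩ hij
          simp only [Finset.mem_erase, ne_eq, Prod.mk.injEq,
            Finset.HasAntidiagonal.mem_antidiagonal] at hij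
          rw [le_div_iff₀ hrn, norm_mul, ← hij.2, pow_add]
          have hb := hN.1 j
          rw [pow_zero, mul_one, ← hω] at hb
          calc _ = (‖PowerSeries.coeff i s‖ * r ^ i) *
                (‖PowerSeries.coeff j (b : PowerSeries ℂ_[p])‖ * r ^ j) := by ring
            _ ≤ (M / ω) * ω := mul_le_mul (ih i (by omega)) hb (by positivity) (by positivity)
            _ = M := by field_simp
      rw [norm_mul, ← hω, le_div_iff₀ hrn] at hle
      rw [le_div_iff₀ hωpos]
      linarith
  | succ N ih =>
    obtain ⟨z, hz, hz0⟩ := exists_zero hr (Nat.succ_ne_zero N) hN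
    obtain ⟨a₁, rfl⟩ := exists_eq_xSub_mul (h.eval_eq_zero hz0)
    obtain ⟨b₁, rfl⟩ := exists_eq_xSub_mul hz0
    obtain ⟨m, hm, hq, hval⟩ := DominantAt.of_xSub_mul hr hz hN
    obtain rfl : N = m := by omega
    have hs₁ : (a₁ : PowerSeries ℂ_[p]) = s * b₁ := by
      have hX : (xSub z : PowerSeries ℂ_[p]) ≠ 0 := by
        simpa using xSub_ne_zero z
      refine mul_left_cancel₀ hX ?_
      rw [MulMemClass.coe_mul, MulMemClass.coe_mul] at hs
      rw [hs]; ring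
    have hM₁ : BoundedAt (a₁ : PowerSeries ℂ_[p]) r (M / r) := by
      have hM0 : 0 ≤ M := le_trans (by positivity) (hM 0)
      rcases eq_or_ne a₁ 0 with rfl | ha
      · intro n; simpa using by positivity
      · obtain ⟨k, hk⟩ := exists_dominantAt (mul_ne_zero (xSub_ne_zero z) ha) hr
        obtain ⟨l, hl, hl', hkl⟩ := DominantAt.of_xSub_mul hr hz hk
        refine hl'.bounded.mono ?_
        rw [le_div_iff₀ hr, mul_comm, ← hkl]
        exact hM k
    have := ih (h.of_mul (xSub_ne_zero z)) hs₁ hq hM₁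
    rwa [div_div, ← hval] at this

theorem LocallyDvd.dvd {a b : Entire p} (hb : b ≠ 0) (h : LocallyDvd b a) : b ∣ a := by
  obtain ⟨s, hs⟩ := h.exists_powerSeries hb
  have hmem : s ∈ Entire p := by
    refine mem_of_bounded fun r hr => ?_
    have hr0 : 0 < r := by linarith
    obtain ⟨N, hN⟩ := exists_dominantAt hb hr0
    obtain ⟨M, hM⟩ := exists_boundedAt a r
    exact ⟨_, h.boundedAt hs hr0 hN hM⟩
  exact ⟨⟨s, hmem⟩, Subtype.ext (by rw [hs, MulMemClass.coe_mul, mul_comm])⟩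

end Entire

end PadicMero

/-! ### Derivatives, the Wronskian and the Schwarzian -/

namespace PadicMero

variable {p : ℕ} [Fact p.Prime]

namespace Entire

open PowerSeries (DominantAt BoundedAt)

/-- The derivative of an entire function. -/
noncomputable def der (f : Entire p) : Entire p :=
  ⟨PowerSeries.derivative ℂ_[p] (f : PowerSeries ℂ_[p]), mem_of_bounded fun r hr => by
    obtain ⟨M, hM⟩ := exists_boundedAt f r
    exact ⟨_, hM.derivative (by linarith)⟩⟩

theorem coe_der (f : Entire p) :
    (der f : PowerSeries ℂ_[p]) = PowerSeries.derivative ℂ_[p] (f : PowerSeries ℂ_[p]) := rfl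

theorem der_add (f g : Entire p) : der (f + g) = der f + der g :=
  Subtype.ext (by simp [coe_der])

theorem der_sub (f g : Entire p) : der (f - g) = der f - der g :=
  Subtype.ext (by simp [coe_der])

theorem der_mul (f g : Entire p) : der (f * g) = der f * g + f * der g :=
  Subtype.ext (by simp [coe_der, Derivation.leibniz]; ring)

theorem der_algebraMap (c : ℂ_[p]) : der (algebraMap ℂ_[p] (Entire p) c) = 0 :=
  Subtype.ext (by simp [coe_der])

theorem der_xSub (z : ℂ_[p]) : der (xSub z) = 1 :=
  Subtype.ext (by simp [coe_der, coe_xSub])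

theorem eval_der_of_eq {f q : Entire p} {x : ℂ_[p]}
    (h : ∀ y, eval f y = eval f x + (y - x) * eval q y) :
    eval (der f) x = eval q x := by
  have : f = algebraMap ℂ_[p] (Entire p) (eval f x) + xSub x * q :=
    ext_eval fun y => by rw [eval_add, eval_mul, eval_algebraMap, eval_xSub, h y]
  rw [this, der_add, der_algebraMap, der_mul, der_xSub]
  simp [eval_add, eval_mul]

/-- Both sides are the value at the base point of the same difference quotient, so no rearrangement
of series is needed. -/
theorem der_translate (c : ℂ_[p]) (f : Entire p) : der (translate c f) = translate c (der f) := by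
  refine ext_eval fun x => ?_
  obtain ⟨q, hq⟩ := exists_eq_xSub_mul
    (f := f - algebraMap ℂ_[p] (Entire p) (eval f (c + x))) (z := c + x)
    (by rw [eval_sub, eval_algebraMap, sub_self])
  have h : ∀ y, eval f y = eval f (c + x) + (y - (c + x)) * eval q y := fun y => by
    have := congrArg (eval · y) hq
    simp only [eval_sub, eval_algebraMap, eval_mul, eval_xSub] at this
    linear_combination this
  rw [eval_translate, eval_der_of_eq h, eval_der_of_eq (q := translate c q), eval_translate]
  intro y
  rw [eval_translate, eval_translate, eval_translate, h (c + y)]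
  ring

/-- The Wronskian `u' v - u v'`. -/
noncomputable def wronskian (u v : Entire p) : Entire p := der u * v - u * der v

/-- The numerator of twice the Schwarzian derivative of `u / v` over the square of the
Wronskian. -/
noncomputable def schwarzian (u v : Entire p) : Entire p :=
  2 * der (der (wronskian u v)) * wronskian u v - 3 * der (wronskian u v) ^ 2 +
    4 * wronskian u v * (der (der u) * der v - der u * der (der v))

theorem coe_wronskian (u v : Entire p) : (wronskian u v : PowerSeries ℂ_[p]) =
    PowerSeries.derivative ℂ_[p] (u : PowerSeries ℂ_[p]) * v -
      u * PowerSeries.derivative ℂ_[p] (v : PowerSeries ℂ_[p]) := rfl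

theorem coe_schwarzian (u v : Entire p) : (schwarzian u v : PowerSeries ℂ_[p]) =
    2 * (der (der (wronskian u v)) : PowerSeries ℂ_[p]) * wronskian u v -
      3 * (der (wronskian u v) : PowerSeries ℂ_[p]) ^ 2 +
      4 * (wronskian u v : PowerSeries ℂ_[p]) * ((der (der u) : PowerSeries ℂ_[p]) * der v -
        (der u : PowerSeries ℂ_[p]) * der (der v)) := rfl

theorem wronskian_mul (h u v : Entire p) : wronskian (h * u) (h * v) = h ^ 2 * wronskian u v := by
  simp only [wronskian, der_mul]; ring

theorem schwarzian_mul (h u v : Entire p) :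
    schwarzian (h * u) (h * v) = h ^ 4 * schwarzian u v := by
  simp only [schwarzian, wronskian, der_mul, der_add, der_sub]; ring

/-- Put `W = wronskian u v` and `X = W' v - 2 W v'`. The logarithmic derivative of `(u / v)' = W / v
^ 2` is `X / (W v)`, and the right side is `2 (X' (W v) - X (W v)') - X ^ 2`. Sums replace the
factors 2 so that `BoundedAt` lemmas apply termwise. -/
theorem schwarzian_mul_sq (u v : Entire p) : schwarzian u v * (v * v) =
    ((der (der (wronskian u v) * v - (wronskian u v * der v + wronskian u v * der v)) *
        (wronskian u v * v) -
      (der (wronskian u v) * v - (wronskian u v * der v + wronskian u v * der v)) *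
        der (wronskian u v * v)) +
    (der (der (wronskian u v) * v - (wronskian u v * der v + wronskian u v * der v)) *
        (wronskian u v * v) -
      (der (wronskian u v) * v - (wronskian u v * der v + wronskian u v * der v)) *
        der (wronskian u v * v))) -
    (der (wronskian u v) * v - (wronskian u v * der v + wronskian u v * der v)) *
    (der (wronskian u v) * v - (wronskian u v * der v + wronskian u v * der v)) := by
  simp only [schwarzian, wronskian, der_mul, der_add, der_sub]; ring

/-- Every term of `schwarzian_mul_sq` carries two derivatives, hence a factor `1 / r ^ 2`;
multiplicativity of the Gauss norm then cancels `v * v`. -/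
theorem boundedAt_schwarzian {u v : Entire p} (hv : v ≠ 0) {r : ℝ} (hr : 0 < r) {N : ℕ}
    (hN : DominantAt (wronskian u v : PowerSeries ℂ_[p]) r N) :
    BoundedAt (schwarzian u v : PowerSeries ℂ_[p]) r
      ((‖PowerSeries.coeff N (wronskian u v : PowerSeries ℂ_[p])‖ * r ^ N) ^ 2 / r ^ 2) := by
  set W := wronskian u v
  set ω := ‖PowerSeries.coeff N (W : PowerSeries ℂ_[p])‖ * r ^ N with hω
  obtain ⟨M, hM⟩ := exists_dominantAt hv hr
  set ν := ‖PowerSeries.coeff M (v : PowerSeries ℂ_[p])‖ * r ^ M with hν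
  have hωpos : 0 < ω := hN.pos hr
  have hνpos : 0 < ν := hM.pos hr
  have hW : BoundedAt (W : PowerSeries ℂ_[p]) r ω := hN.bounded
  have hvb : BoundedAt (v : PowerSeries ℂ_[p]) r ν := hM.bounded
  have hWv' : BoundedAt ((W * der v : Entire p) : PowerSeries ℂ_[p]) r (ω * ν / r) :=
    (BoundedAt.mul hr hW (hvb.derivative hr)).mono (le_of_eq (mul_div_assoc _ _ _).symm)
  have hX : BoundedAt ((der W * v - (W * der v + W * der v) : Entire p) : PowerSeries ℂ_[p]) r
      (ω * ν / r) :=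
    (((hW.derivative hr).mul hr hvb).sub hr (hWv'.add hr hWv')).mono
      (by rw [max_self, max_le_iff]; exact ⟨le_of_eq (div_mul_eq_mul_div _ _ _), le_rfl⟩)
  have hY : BoundedAt ((W * v : Entire p) : PowerSeries ℂ_[p]) r (ω * ν) := hW.mul hr hvb
  have hA := ((hX.derivative hr).mul hr hY).sub hr (hX.mul hr (hY.derivative hr))
  have hB := (hA.add hr hA).sub hr (hX.mul hr hX)
  have key : BoundedAt ((schwarzian u v * (v * v) : Entire p) : PowerSeries ℂ_[p]) r
      ((ω * ν) ^ 2 / r ^ 2) := by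
    rw [schwarzian_mul_sq]
    refine PowerSeries.BoundedAt.mono hB (le_of_eq ?_)
    have e1 : ω * ν / r / r * (ω * ν) = (ω * ν) ^ 2 / r ^ 2 := by field_simp
    have e2 : ω * ν / r * (ω * ν / r) = (ω * ν) ^ 2 / r ^ 2 := by field_simp
    rw [e1, e2, max_self, max_self, max_self]
  rcases eq_or_ne (schwarzian u v) 0 with h0 | h0
  · intro n
    rw [h0]
    simpa using by positivity
  · obtain ⟨k, hk⟩ := exists_dominantAt h0 hr
    refine hk.bounded.mono ?_
    have h1 := key (k + (M + M))
    rw [MulMemClass.coe_mul, MulMemClass.coe_mul, hk.norm_coeff_mul hr (hM.mul hr hM),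
      hM.norm_coeff_mul hr hM, ← hν] at h1
    refine le_of_mul_le_mul_right (h1.trans (le_of_eq ?_)) (mul_pos hνpos hνpos)
    ring

/-- A quotient of entire functions without ramification has vanishing Schwarzian derivative. -/
theorem schwarzian_eq_zero {u v : Entire p} (hv : v ≠ 0)
    (h : ∀ b, ∃ d u' v' : Entire p, u = d * u' ∧ v = d * v' ∧ eval (wronskian u' v') b ≠ 0) :
    wronskian u v ≠ 0 ∧ schwarzian u v = 0 := by
  have hW : wronskian u v ≠ 0 := by
    obtain ⟨d, u', v', rfl, rfl, hne⟩ := h 0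
    rw [wronskian_mul]
    refine mul_ne_zero (pow_ne_zero _ (left_ne_zero_of_mul hv)) ?_
    intro h0
    simp [h0] at hne
  -- A common factor `d` contributes `d ^ 4` to both sides, so the reduced pair, whose Wronskian is
  -- nonzero at `b`, decides.
  have hloc : LocallyDvd (wronskian u v * wronskian u v) (schwarzian u v) := by
    intro b
    obtain ⟨d, u', v', rfl, rfl, hne⟩ := h b
    refine ⟨wronskian u' v' * wronskian u' v', by simp [eval_mul, hne], schwarzian u' v', ?_⟩
    rw [wronskian_mul, schwarzian_mul]; ring
  refine ⟨hW, ?_⟩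
  obtain ⟨s, hs⟩ := hloc.exists_powerSeries (mul_ne_zero hW hW)
  have hbound : ∀ r : ℝ, 0 < r → BoundedAt s r (1 / r ^ 2) := by
    intro r hr
    obtain ⟨N, hN⟩ := exists_dominantAt hW hr
    have hpos := hN.pos hr
    have := hloc.boundedAt hs hr (N := N + N) (by
      rw [MulMemClass.coe_mul]; exact hN.mul hr hN) (boundedAt_schwarzian hv hr hN)
    refine this.mono (le_of_eq ?_)
    rw [MulMemClass.coe_mul, hN.norm_coeff_mul hr hN]
    generalize ‖PowerSeries.coeff N (wronskian u v : PowerSeries ℂ_[p])‖ * r ^ N = ω at hpos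
    field_simp
  have hs0 : s = 0 := by
    ext n
    by_contra hne
    have hpos : 0 < ‖PowerSeries.coeff n s‖ := norm_pos_iff.2 hne
    obtain ⟨r, hr1, hr2⟩ := (((tendsto_pow_atTop (α := ℝ) (show n + 2 ≠ 0 by omega)).const_mul_atTop
      hpos).eventually (eventually_gt_atTop 1) |>.and (eventually_gt_atTop 0)).exists
    have := hbound r hr2 n
    rw [le_div_iff₀ (by positivity), mul_assoc, ← pow_add] at this
    exact absurd hr1 (not_lt.2 this)
  exact Subtype.ext (by rw [hs, hs0]; simp)

end Entire

-- Here `g = 1 / f'` for `f = u / v`. A vanishing Schwarzian means `2 g g'' = g' ^ 2`;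
-- differentiating gives `g''' = 0`, so `g` is a polynomial of degree at most 2, and `f' = 1 / g`
-- integrates to a rational function.
open PowerSeries in
theorem exists_polynomial_of_powerSeries {K : Type*} [Field K] [CharZero K]
    {u v W g : PowerSeries K}
    (hv0 : constantCoeff v ≠ 0) (hW0 : constantCoeff W ≠ 0)
    (hW : W = derivative K u * v - u * derivative K v)
    (hg : W * g = v ^ 2)
    (hS : 2 * derivative K (derivative K W) * W - 3 * derivative K W ^ 2 + 4 * W *
      (derivative K (derivative K u) * derivative K v -
        derivative K u * derivative K (derivative K v)) = 0) :
    ∃ P Q : Polynomial K, Q ≠ 0 ∧ u * (Q : PowerSeries K) = v * (P : PowerSeries K) := by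
  have hWne : W ≠ 0 := by rintro rfl; simp at hW0
  have hvne : v ≠ 0 := by rintro rfl; simp at hv0
  have hg0 : constantCoeff g ≠ 0 := by
    intro h
    have := congrArg constantCoeff hg
    rw [map_mul, h, mul_zero, map_pow] at this
    exact hv0 (pow_eq_zero_iff two_ne_zero |>.1 this.symm)
  have hgne : g ≠ 0 := by rintro rfl; simp at hg0
  have h20 : (2 : PowerSeries K) ≠ 0 := fun h => by
    have := congrArg constantCoeff h
    rw [map_ofNat, map_zero] at this
    exact two_ne_zero this
  have D2 : ∀ a : PowerSeries K, derivative K (a ^ 2) = 2 * a * derivative K a := fun a => by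
    rw [sq, Derivation.leibniz]; simp only [smul_eq_mul]; ring
  have hn2 : derivative K (2 : PowerSeries K) = 0 := by
    exact_mod_cast Derivation.map_natCast (derivative K) 2
  have d1 : derivative K W * g + W * derivative K g = 2 * v * derivative K v := by
    have := congrArg (derivative K) hg
    rw [D2, Derivation.leibniz] at this
    simp only [smul_eq_mul] at this
    linear_combination this
  have d2 : derivative K (derivative K W) * g + 2 * derivative K W * derivative K g +
      W * derivative K (derivative K g) =
      2 * derivative K v ^ 2 + 2 * v * derivative K (derivative K v) := by
    have := congrArg (derivative K) d1
    simp only [Derivation.leibniz, map_add, smul_eq_mul, hn2] at this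
    linear_combination this
  have dW : derivative K W =
      derivative K (derivative K u) * v - u * derivative K (derivative K v) := by
    rw [hW]; simp only [Derivation.leibniz, map_sub, smul_eq_mul]; ring
  set v' := derivative K v
  set v'' := derivative K v'
  set u' := derivative K u
  set u'' := derivative K u'
  set W' := derivative K W
  set W'' := derivative K W'
  set g' := derivative K g with hg'
  set g'' := derivative K g' with hg''
  have e1 : W ^ 2 * g' = 2 * v * v' * W - W' * v ^ 2 := by
    linear_combination W * d1 - W' * hg
  have e2 : W ^ 3 * g'' = W ^ 2 * (2 * v' ^ 2 + 2 * v * v'') - W * W'' * v ^ 2 -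
      2 * W' * (2 * v * v' * W - W' * v ^ 2) := by
    linear_combination W ^ 2 * d2 - W * W'' * hg - 2 * W' * e1
  -- Eliminates the derivatives of `u`, leaving an equation in `v` and `W` alone.
  have hQ : v * (u'' * v' - u' * v'') = W' * v' - W * v'' := by
    rw [dW, hW]; ring
  have hode : 2 * g * g'' = g' ^ 2 := by
    have hW4 : W ^ 4 ≠ 0 := pow_ne_zero _ hWne
    refine mul_left_cancel₀ hW4 ?_
    have h1 : W ^ 4 * (2 * g * g'') = 2 * (W * g) * (W ^ 3 * g'') := by ring
    have h2 : W ^ 4 * g' ^ 2 = (W ^ 2 * g') ^ 2 := by ring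
    rw [h1, h2, hg, e1, e2]
    linear_combination (-v ^ 4) * hS + 4 * W * v ^ 3 * hQ
  have hg3 : derivative K g'' = 0 := by
    have := congrArg (derivative K) hode
    rw [D2] at this
    simp only [Derivation.leibniz, smul_eq_mul, hn2] at this
    have h2 : (2 : PowerSeries K) * g ≠ 0 := mul_ne_zero h20 hgne
    refine (mul_eq_zero.1 (?_ : (2 * g) * derivative K g'' = 0)).resolve_left h2
    linear_combination this
  have hconst : ∀ a : PowerSeries K, derivative K a = 0 → a = C (constantCoeff a) := fun a ha =>
    derivative.ext (by rw [ha, derivative_C]) (by simp)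
  obtain ⟨c, hc⟩ : ∃ c, g'' = C c := ⟨_, hconst _ hg3⟩
  -- the quotient `u / v`
  obtain ⟨f, hf⟩ : ∃ f, f = u * v⁻¹ := ⟨_, rfl⟩
  have hfv : v * f = u := by
    rw [hf, mul_left_comm, PowerSeries.mul_inv_cancel _ hv0, mul_one]
  have hf' : derivative K f * g = 1 := by
    have h1 := congrArg (derivative K) hfv
    rw [Derivation.leibniz] at h1
    simp only [smul_eq_mul] at h1
    have h2 : v ^ 2 * derivative K f = W := by
      rw [hW]
      linear_combination v * h1 - v' * hfv
    refine mul_left_cancel₀ hWne ?_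
    linear_combination derivative K f * hg + h2
  rcases eq_or_ne c 0 with rfl | hc0
  · rw [map_zero] at hc
    have hg'0 : g' = 0 := by
      rw [hc, mul_zero] at hode
      exact pow_eq_zero_iff two_ne_zero |>.1 hode.symm
    have hgc := hconst g hg'0
    set k := constantCoeff g
    have hfk : f = C (constantCoeff f) + C k⁻¹ * X := by
      refine derivative.ext ?_ (by simp)
      have h1 : derivative K f * C k = 1 := by rw [← hgc]; exact hf'
      have h2 : derivative K f = C k⁻¹ := by
        have : C k * C k⁻¹ = (1 : PowerSeries K) := by
          rw [← map_mul, mul_inv_cancel₀ hg0, map_one]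
        calc derivative K f = derivative K f * C k * C k⁻¹ := by rw [mul_assoc, this, mul_one]
          _ = C k⁻¹ := by rw [h1, one_mul]
      rw [h2]
      simp [Derivation.leibniz]
    refine ⟨Polynomial.C (constantCoeff f) + Polynomial.C k⁻¹ * Polynomial.X, 1, one_ne_zero, ?_⟩
    rw [← hfv, hfk]
    simp
  · have hg4 : ∀ n, 2 < n → coeff n g = 0 := by
      intro n hn
      obtain ⟨m, rfl⟩ : ∃ m, n = m + 3 := ⟨n - 3, by omega⟩
      have := congrArg (coeff m) hg3
      rw [hg'', hg', coeff_derivative, coeff_derivative, coeff_derivative, map_zero] at this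
      have h1 : ((m : K) + 1) ≠ 0 := by exact_mod_cast Nat.succ_ne_zero m
      have h2 : (m : K) + 1 + 1 ≠ 0 := by exact_mod_cast Nat.succ_ne_zero (m + 1)
      have h3 : (m : K) + 1 + 1 + 1 ≠ 0 := by exact_mod_cast Nat.succ_ne_zero (m + 2)
      simpa [h1, h2, h3] using this
    obtain ⟨G, hG⟩ : ∃ G : Polynomial K, (G : PowerSeries K) = g := by
      refine ⟨trunc 3 g, ?_⟩
      ext n
      rw [Polynomial.coeff_coe, coeff_trunc]
      split_ifs with h
      · rfl
      · exact (hg4 n (by omega)).symm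
    -- As `g' ^ 2 = 2 c g`, the derivative of `g' / g` is `-c / g = -c f'`. Hence `f = (k g - g') /
    -- (c g)`.
    have hk : derivative K (C c * f + g' * g⁻¹) = 0 := by
      have hgi : g * g⁻¹ = 1 := PowerSeries.mul_inv_cancel _ hg0
      rw [map_add, Derivation.leibniz, Derivation.leibniz, derivative_C, derivative_inv', ← hg', ← hg'',
        hc]
      simp only [smul_eq_mul]
      rw [hc] at hode
      refine (mul_eq_zero.1 (?_ : g ^ 2 * _ = 0)).resolve_left (pow_ne_zero 2 hgne)
      linear_combination C c * g * hf' - g' ^ 2 * (g * g⁻¹ + 1) * hgi + hode + C c * g * hgi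
    have hk' := hconst _ hk
    set k := constantCoeff (C c * f + g' * g⁻¹)
    refine ⟨Polynomial.C k * G - Polynomial.derivative G, Polynomial.C c * G,
      mul_ne_zero (by simpa using hc0) ?_, ?_⟩
    · rintro rfl
      exact hgne (by simpa using hG.symm)
    · rw [Polynomial.coe_mul, Polynomial.coe_sub, Polynomial.coe_mul, Polynomial.coe_C,
        Polynomial.coe_C, ← derivative_coe, hG, ← hg', ← hfv]
      have hgi : g * g⁻¹ = 1 := PowerSeries.mul_inv_cancel _ hg0
      linear_combination v * g * hk' - v * g' * hgi

namespace Entire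

theorem wronskian_translate (c : ℂ_[p]) (u v : Entire p) :
    wronskian (translate c u) (translate c v) = translate c (wronskian u v) := by
  refine ext_eval fun x => ?_
  simp only [wronskian, der_translate, eval_sub, eval_mul, eval_translate]

theorem schwarzian_translate (c : ℂ_[p]) (u v : Entire p) :
    schwarzian (translate c u) (translate c v) = translate c (schwarzian u v) := by
  refine ext_eval fun x => ?_
  rw [eval_translate, schwarzian, schwarzian, wronskian_translate]
  simp only [der_translate, ← evalHom_apply, map_add, map_sub, map_mul, map_pow, map_ofNat]
  simp only [evalHom_apply, eval_translate]

theorem constantCoeff_eq_eval (f : Entire p) :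
    PowerSeries.constantCoeff (f : PowerSeries ℂ_[p]) = eval f 0 := by
  rw [eval, tsum_eq_single 0 (by intro n hn; simp [hn])]
  simp

theorem exists_polynomial_of_schwarzian {u v : Entire p} (hv : eval v 0 ≠ 0)
    (hW : eval (wronskian u v) 0 ≠ 0) (hS : schwarzian u v = 0) :
    ∃ P Q : Polynomial ℂ_[p], Q ≠ 0 ∧ u * ofPolynomial Q = v * ofPolynomial P := by
  rw [← constantCoeff_eq_eval] at hv hW
  have hS' := coe_schwarzian u v
  rw [hS, ZeroMemClass.coe_zero] at hS'
  have hg : (wronskian u v : PowerSeries ℂ_[p]) * ((wronskian u v : PowerSeries ℂ_[p])⁻¹ *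
      (v : PowerSeries ℂ_[p]) ^ 2) = (v : PowerSeries ℂ_[p]) ^ 2 := by
    rw [← mul_assoc, PowerSeries.mul_inv_cancel _ hW, one_mul]
  obtain ⟨P, Q, hQ, hPQ⟩ := exists_polynomial_of_powerSeries hv hW (coe_wronskian u v) hg hS'.symm
  exact ⟨P, Q, hQ, Subtype.ext hPQ⟩

theorem ofPolynomial_ne_zero {Q : Polynomial ℂ_[p]} (hQ : Q ≠ 0) : ofPolynomial Q ≠ 0 :=
  fun h => hQ (ofPolynomial_injective (h.trans (map_zero ofPolynomialHom).symm))

/-- A quotient of entire functions without ramification is rational. -/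
theorem exists_polynomial_of_unramified {u v : Entire p} (hv : v ≠ 0)
    (h : ∀ b, ∃ d u' v' : Entire p, u = d * u' ∧ v = d * v' ∧ eval (wronskian u' v') b ≠ 0) :
    ∃ P Q : Polynomial ℂ_[p], Q ≠ 0 ∧ u * ofPolynomial Q = v * ofPolynomial P := by
  obtain ⟨hW, hS⟩ := schwarzian_eq_zero hv h
  -- The formal argument needs `v` and the Wronskian invertible at the origin, so the origin is
  -- moved to a point where neither vanishes.
  obtain ⟨c, hc⟩ := exists_eval_ne_zero (mul_ne_zero hW hv)
  rw [eval_mul] at hc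
  have hSt : schwarzian (translate c u) (translate c v) = 0 := by
    rw [schwarzian_translate, hS]
    exact ext_eval fun x => by simp
  obtain ⟨P, Q, hQ, hPQ⟩ := exists_polynomial_of_schwarzian (u := translate c u)
    (v := translate c v) (by simpa using right_ne_zero_of_mul hc)
    (by rw [wronskian_translate]; simpa using left_ne_zero_of_mul hc) hSt
  refine ⟨P.comp (Polynomial.C (-c) + Polynomial.X), Q.comp (Polynomial.C (-c) + Polynomial.X),
    ?_, ?_⟩
  · intro h0
    have := translate_ne_zero (-c) (ofPolynomial_ne_zero hQ)
    rw [translate_ofPolynomial, h0] at this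
    exact this (map_zero ofPolynomialHom)
  · have := congrArg (translate (-c)) hPQ
    rwa [translate_mul, translate_mul, translate_neg_translate, translate_neg_translate,
      translate_ofPolynomial, translate_ofPolynomial] at this

end Entire

end PadicMero

/-! ### Values and orders of meromorphic functions, rationality, and the inner factor -/

namespace PadicMero

variable {p : ℕ} [Fact p.Prime]

namespace Mero

open Entire
open PowerSeries (DominantAt BoundedAt)

theorem algebraMap_ne_zero {v : Entire p} (hv : v ≠ 0) : algebraMap (Entire p) (Mero p) v ≠ 0 :=
  (map_ne_zero_iff _ (IsFractionRing.injective (Entire p) (Mero p))).2 hv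

theorem exists_eq_div (h : Mero p) : ∃ u v : Entire p, v ≠ 0 ∧
    h = algebraMap (Entire p) (Mero p) u / algebraMap (Entire p) (Mero p) v := by
  obtain ⟨u, v, hv, rfl⟩ := IsFractionRing.div_surjective (A := Entire p) h
  exact ⟨u, v, nonZeroDivisors.ne_zero hv, rfl⟩

theorem div_eq_div_iff' {u v u' v' : Entire p} (hv : v ≠ 0) (hv' : v' ≠ 0) :
    algebraMap (Entire p) (Mero p) u / algebraMap (Entire p) (Mero p) v =
      algebraMap (Entire p) (Mero p) u' / algebraMap (Entire p) (Mero p) v' ↔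
      u * v' = u' * v := by
  rw [div_eq_div_iff (algebraMap_ne_zero hv) (algebraMap_ne_zero hv'), ← map_mul, ← map_mul,
    (IsFractionRing.injective (Entire p) (Mero p)).eq_iff]

theorem ne_zero_of_eval {v : Entire p} {x : ℂ_[p]} (h : eval v x ≠ 0) : v ≠ 0 := by
  rintro rfl
  simp at h

theorem value_eq_coe {u v : Entire p} {x : ℂ_[p]} (hx : eval v x ≠ 0) :
    value (algebraMap (Entire p) (Mero p) u / algebraMap (Entire p) (Mero p) v) x =
      ((eval u x / eval v x : ℂ_[p]) : OnePoint ℂ_[p]) := by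
  have H : ∃ c, HasValueAt (algebraMap (Entire p) (Mero p) u / algebraMap (Entire p) (Mero p) v)
      x c := ⟨_, u, v, hx, rfl, rfl⟩
  rw [value, dif_pos H]
  obtain ⟨u', v', hx', he, hc⟩ := H.choose_spec
  rw [← hc, OnePoint.coe_eq_coe]
  have := congrArg (eval · x) ((div_eq_div_iff' (ne_zero_of_eval hx) (ne_zero_of_eval hx')).1 he)
  simp only [eval_mul] at this
  rw [div_eq_div_iff hx' hx, this]

theorem value_eq_infty {u v : Entire p} {x : ℂ_[p]} (hv : v ≠ 0) (hx : eval v x = 0)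
    (hu : eval u x ≠ 0) :
    value (algebraMap (Entire p) (Mero p) u / algebraMap (Entire p) (Mero p) v) x =
      OnePoint.infty := by
  rw [value, dif_neg]
  rintro ⟨c, u', v', hx', he, -⟩
  have := congrArg (eval · x) ((div_eq_div_iff' hv (ne_zero_of_eval hx')).1 he)
  simp only [eval_mul, hx, mul_zero, mul_eq_zero] at this
  exact this.elim hu hx'

/-- The value of a meromorphic function, with `0` at the poles. -/
noncomputable def finiteValue (h : Mero p) (z : ℂ_[p]) : ℂ_[p] := (value h z).elim 0 id

theorem finiteValue_eq_div {u v : Entire p} {x : ℂ_[p]} (hv : v ≠ 0)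
    (hx : eval u x ≠ 0 ∨ eval v x ≠ 0) :
    finiteValue (algebraMap (Entire p) (Mero p) u / algebraMap (Entire p) (Mero p) v) x =
      eval u x / eval v x := by
  by_cases h : eval v x = 0
  · rw [finiteValue, value_eq_infty hv h (hx.resolve_right (not_not.2 h)), h, div_zero]
    rfl
  · rw [finiteValue, value_eq_coe h]
    rfl

theorem order_ne_top {h : Mero p} (hh : h ≠ 0) (x : ℂ_[p]) : order h x ≠ ⊤ := by
  obtain ⟨u, v, hv, rfl⟩ := exists_eq_div h
  have hu : u ≠ 0 := by
    rintro rfl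
    simp at hh
  have hmer : MeromorphicAt (fun z => eval u z / eval v z) x :=
    (analyticAt u x).meromorphicAt.div (analyticAt v x).meromorphicAt
  have hcongr : finiteValue (algebraMap (Entire p) (Mero p) u / algebraMap (Entire p) (Mero p) v)
      =ᶠ[𝓝[≠] x] fun z => eval u z / eval v z := by
    filter_upwards [eventually_eval_ne_zero hv x] with z hz
    exact finiteValue_eq_div hv (Or.inr hz)
  change meromorphicOrderAt (finiteValue _) x ≠ ⊤
  rw [meromorphicOrderAt_congr hcongr, meromorphicOrderAt_ne_top_iff_eventually_ne_zero hmer]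
  filter_upwards [eventually_eval_ne_zero hv x, eventually_eval_ne_zero hu x] with z h1 h2
  exact div_ne_zero h2 h1

theorem isRational_of_mul_eq {u v : Entire p} (hv : v ≠ 0) {P Q : Polynomial ℂ_[p]} (hQ : Q ≠ 0)
    (h : u * ofPolynomial Q = v * ofPolynomial P) :
    IsRational (algebraMap (Entire p) (Mero p) u / algebraMap (Entire p) (Mero p) v) :=
  ⟨P, Q, hQ, (div_eq_div_iff' hv (ofPolynomial_ne_zero hQ)).2 (by rw [h, mul_comm])⟩

theorem isRational_ofPolynomial (P : Polynomial ℂ_[p]) :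
    IsRational (algebraMap (Entire p) (Mero p) (ofPolynomial P)) := by
  have := isRational_of_mul_eq (u := ofPolynomial P) (v := 1) one_ne_zero (P := P) (Q := 1)
    one_ne_zero (by rw [one_mul, show (ofPolynomial 1 : Entire p) = 1 from map_one ofPolynomialHom,
      mul_one])
  rwa [map_one, div_one] at this

theorem IsTranscendental.ne_zero {F : Mero p} (hF : F.IsTranscendental) : F ≠ 0 := by
  rintro rfl
  refine hF ?_
  have := isRational_ofPolynomial (p := p) 0
  rwa [show (ofPolynomial 0 : Entire p) = 0 from map_zero ofPolynomialHom, map_zero] at this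

/-- A meromorphic function without zeros and poles outside a disc is rational. -/
theorem isRational_of_forall_value_ne {f : Mero p} {R : ℝ}
    (h0 : ∀ b : ℂ_[p], R < ‖b‖ → value f b ≠ ((0 : ℂ_[p]) : OnePoint ℂ_[p]))
    (hinf : ∀ b : ℂ_[p], R < ‖b‖ → value f b ≠ OnePoint.infty) : IsRational f := by
  obtain ⟨u, v, hv, rfl⟩ := exists_eq_div f
  have hr : 0 < max R 1 := by positivity
  obtain ⟨Q, e, hQ, rfl, he⟩ := exists_eq_ofPolynomial_mul hv hr
  have he0 : e ≠ 0 := right_ne_zero_of_mul hv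
  have hQ0 := ofPolynomial_ne_zero hQ
  have hloc : LocallyDvd e u := by
    intro b
    rcases le_or_gt ‖b‖ (max R 1) with hb | hb
    · exact ⟨e, he b hb, dvd_mul_left e u⟩
    · obtain ⟨m, u', v', rfl, hv', hne⟩ := exists_eq_xSub_pow_mul_pair u hv b
      have hv'0 : v' ≠ 0 := by
        rintro rfl
        rw [mul_zero] at hv'
        exact hv hv'
      -- Outside the disc `f` has no pole, so the reduced denominator `v'` is nonzero at `b`.
      refine ⟨v', fun hvb => ?_, ofPolynomial Q * u', ?_⟩
      · refine hinf b (lt_of_le_of_lt (le_max_left _ _) hb) ?_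
        rw [(div_eq_div_iff' (u' := u') hv hv'0).2 (by rw [hv']; ring)]
        exact value_eq_infty hv'0 hvb (hne.resolve_right (not_not.2 hvb))
      · calc xSub b ^ m * u' * v' = (xSub b ^ m * v') * u' := by ring
          _ = e * (ofPolynomial Q * u') := by rw [← hv']; ring
  obtain ⟨w, rfl⟩ := hloc.dvd he0
  have hval : algebraMap (Entire p) (Mero p) (e * w) /
      algebraMap (Entire p) (Mero p) (ofPolynomial Q * e) =
      algebraMap (Entire p) (Mero p) w / algebraMap (Entire p) (Mero p) (ofPolynomial Q) :=
    (div_eq_div_iff' hv hQ0).2 (by ring)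
  rw [hval] at h0 ⊢
  have hw : ∃ P, w = ofPolynomial P := by
    by_contra! hw
    have hw0 : w ≠ 0 := fun h => hw 0 (by rw [h]; exact (map_zero ofPolynomialHom).symm)
    obtain ⟨S, e', hS, rfl, he'⟩ := exists_eq_ofPolynomial_mul hw0 hr
    -- A zero of `w` is a root of `Q` or a zero of `f`; the latter lies in the disc, hence is a root
    -- of `S`.
    refine infinite_zeros hw (((Q.rootSet_finite ℂ_[p]).union (S.rootSet_finite ℂ_[p])).subset ?_)
    intro z hz
    by_cases hQz : eval (ofPolynomial Q) z = 0
    · left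
      rw [eval_ofPolynomial] at hQz
      exact Polynomial.mem_rootSet.2 ⟨hQ, by simpa using hQz⟩
    · right
      have hzR : ‖z‖ ≤ R := by
        by_contra hzR
        refine h0 z (not_le.1 hzR) ?_
        rw [value_eq_coe hQz, show eval (ofPolynomial S * e') z = 0 from hz, zero_div]
      have hz' : eval (ofPolynomial S * e') z = 0 := hz
      rw [eval_mul, mul_eq_zero] at hz'
      have := hz'.resolve_right (he' z (hzR.trans (le_max_left _ _)))
      rw [eval_ofPolynomial] at this
      exact Polynomial.mem_rootSet.2 ⟨hS, by simpa using this⟩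
  obtain ⟨P, rfl⟩ := hw
  exact ⟨P, Q, hQ, rfl⟩

/-- Close to a pole, a meromorphic function takes every value of large absolute value. -/
theorem exists_solution_near_pole {a c : Entire p} {x₀ : ℂ_[p]} (hc : c ≠ 0) (hcx : eval c x₀ = 0)
    (ha : eval a x₀ ≠ 0) {ρ : ℝ} (hρ : 0 < ρ) :
    ∃ R : ℝ, ∀ b : ℂ_[p], R < ‖b‖ → ∃ x, x ≠ x₀ ∧ ‖x - x₀‖ ≤ ρ ∧ eval a x = b * eval c x := by
  set A := translate x₀ a
  set C := translate x₀ c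
  obtain ⟨N, hN⟩ := exists_dominantAt (translate_ne_zero x₀ hc) hρ
  obtain ⟨M, hM⟩ := exists_boundedAt A ρ
  set ω := ‖PowerSeries.coeff N (C : PowerSeries ℂ_[p])‖ * ρ ^ N with hω
  have hωpos : 0 < ω := hN.pos hρ
  have hM0 : 0 ≤ M := le_trans (by positivity) (hM 0)
  have hC0 : PowerSeries.coeff 0 (C : PowerSeries ℂ_[p]) = 0 := by
    rw [PowerSeries.coeff_zero_eq_constantCoeff_apply, constantCoeff_eq_eval]
    simpa [C] using hcx
  refine ⟨M / ω, fun b hb => ?_⟩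
  have hbpos : 0 < ‖b‖ := lt_of_le_of_lt (by positivity) hb
  have hb0 : b ≠ 0 := norm_pos_iff.1 hbpos
  have hsmall : ∀ n, ‖b⁻¹ * PowerSeries.coeff n (A : PowerSeries ℂ_[p])‖ * ρ ^ n < ω := by
    intro n
    rw [norm_mul, norm_inv, mul_assoc, inv_mul_lt_iff₀ hbpos]
    rw [div_lt_iff₀ hωpos] at hb
    exact (hM n).trans_lt hb
  -- A zero of `H` solves `a / c = b`. For large `b`, `H` is a small perturbation of `C`, and `C`
  -- vanishes at the origin. The constant term of `H` is therefore too small to dominate, which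
  -- forces a zero in the disc.
  set H := C - ofPolynomial (Polynomial.C b⁻¹) * A with hH
  have hcoeff : ∀ n, PowerSeries.coeff n (H : PowerSeries ℂ_[p]) =
      PowerSeries.coeff n (C : PowerSeries ℂ_[p]) -
        b⁻¹ * PowerSeries.coeff n (A : PowerSeries ℂ_[p]) := by
    intro n
    simp [hH, ofPolynomial]
  have hHN : ‖PowerSeries.coeff N (H : PowerSeries ℂ_[p])‖ * ρ ^ N = ω := by
    have hlt : ‖-(b⁻¹ * PowerSeries.coeff N (A : PowerSeries ℂ_[p]))‖ <
        ‖PowerSeries.coeff N (C : PowerSeries ℂ_[p])‖ := by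
      rw [norm_neg]
      exact lt_of_mul_lt_mul_right (hsmall N) (by positivity)
    rw [hcoeff, sub_eq_add_neg, IsUltrametricDist.norm_add_eq_max_of_norm_ne_norm hlt.ne',
      max_eq_left hlt.le]
  have hH0 : H ≠ 0 := by
    intro h
    rw [h] at hHN
    simp only [ZeroMemClass.coe_zero, map_zero, norm_zero, zero_mul] at hHN
    exact hωpos.ne hHN
  obtain ⟨k, hk⟩ := exists_dominantAt hH0 hρ
  have hk0 : k ≠ 0 := by
    rintro rfl
    have h1 := hk.1 N
    rw [hHN, hcoeff, hC0, zero_sub, norm_neg] at h1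
    exact absurd (hsmall 0) (not_lt.2 h1)
  obtain ⟨y, hy, hy0⟩ := exists_zero hρ hk0 hk
  have heq : eval a (x₀ + y) = b * eval c (x₀ + y) := by
    rw [hH, eval_sub, eval_mul, eval_ofPolynomial, Polynomial.eval_C, eval_translate,
      eval_translate] at hy0
    field_simp at hy0
    linear_combination -hy0
  refine ⟨x₀ + y, fun hx => ha ?_, by simpa using hy, heq⟩
  rw [hx, hcx, mul_zero] at heq
  exact heq

/-- The inner factor of a nontrivial factorization is entire. -/
theorem IsComp.exists_entire {F f g : Mero p} (hcomp : IsComp F f g) (hF : F ≠ 0)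
    (hf : ¬ IsRational f) : ∃ G : Entire p, g = algebraMap (Entire p) (Mero p) G := by
  obtain ⟨a, c, hc, rfl⟩ := exists_eq_div g
  suffices hloc : LocallyDvd c a by
    obtain ⟨G, rfl⟩ := hloc.dvd hc
    exact ⟨G, by rw [map_mul, mul_div_cancel_left₀ _ (algebraMap_ne_zero hc)]⟩
  intro x₀
  obtain ⟨m, a', c', rfl, rfl, hne⟩ := exists_eq_xSub_pow_mul_pair a hc x₀
  have hc' : c' ≠ 0 := right_ne_zero_of_mul hc
  by_cases hcx : eval c' x₀ = 0
  swap
  · exact ⟨c', hcx, a', by ring⟩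
  exfalso
  have hax := hne.resolve_right (not_not.2 hcx)
  obtain ⟨U, V, hV, rfl⟩ := exists_eq_div F
  have hU : U ≠ 0 := by
    rintro rfl
    simp at hF
  have hev := ((eventually_eval_ne_zero hU x₀).and (eventually_eval_ne_zero hV x₀)).and
    (eventually_eval_ne_zero hc' x₀)
  rw [eventually_nhdsWithin_iff, Metric.eventually_nhds_iff] at hev
  obtain ⟨ε, hε, hball⟩ := hev
  obtain ⟨R, hR⟩ := exists_solution_near_pole hc' hcx hax (half_pos hε)
  -- Every large `b` is `g(x)` for some `x` in a punctured disc where `F` is finite and nonzero, so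
  -- `f(b) = F(x)` is too.
  have hval : ∀ b : ℂ_[p], R < ‖b‖ → ∃ t : ℂ_[p], t ≠ 0 ∧ value f b = (t : OnePoint ℂ_[p]) := by
    intro b hb
    obtain ⟨x, hx, hxρ, hxb⟩ := hR b hb
    obtain ⟨⟨hUx, hVx⟩, hcx'⟩ := hball (by rw [dist_eq_norm]; linarith) hx
    refine ⟨eval U x / eval V x, div_ne_zero hUx hVx, ?_⟩
    rw [← hcomp x b, value_eq_coe hVx]
    rw [(div_eq_div_iff' (u' := a') hc hc').2 (by ring), value_eq_coe hcx', hxb,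
      mul_div_cancel_right₀ _ hcx']
  refine hf (isRational_of_forall_value_ne (R := R) (fun b hb h => ?_) fun b hb h => ?_)
  · obtain ⟨t, ht, ht'⟩ := hval b hb
    exact ht (OnePoint.coe_eq_coe.1 (ht'.symm.trans h))
  · obtain ⟨t, -, ht'⟩ := hval b hb
    exact OnePoint.coe_ne_infty t (ht'.symm.trans h)

/-! ### Multiplicities under composition and the conclusion -/

theorem two_le_meromorphicOrderAt {φ k : ℂ_[p] → ℂ_[p]} {x : ℂ_[p]} (hk : AnalyticAt ℂ_[p] k x)
    (h : φ =ᶠ[𝓝[≠] x] fun z => (z - x) ^ 2 * k z) : 2 ≤ meromorphicOrderAt φ x := by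
  have hpow : AnalyticAt ℂ_[p] (fun z : ℂ_[p] => (z - x) ^ 2) x := by fun_prop
  rw [meromorphicOrderAt_congr h]
  have := meromorphicOrderAt_mul hpow.meromorphicAt hk.meromorphicAt
  rw [show (fun z => (z - x) ^ 2 * k z) = (fun z : ℂ_[p] => (z - x) ^ 2) * k from rfl, this,
    show (fun z : ℂ_[p] => (z - x) ^ 2) = (· - x) ^ 2 from rfl, meromorphicOrderAt_pow_id_sub_const]
  exact le_add_of_nonneg_right hk.meromorphicOrderAt_nonneg

theorem finiteValue_comp {F f : Mero p} {G : Entire p}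
    (hcomp : IsComp F f (algebraMap (Entire p) (Mero p) G)) (x : ℂ_[p]) :
    finiteValue F x = finiteValue f (eval G x) := by
  have h : value (algebraMap (Entire p) (Mero p) G) x = (eval G x : OnePoint ℂ_[p]) := by
    have := value_eq_coe (u := G) (v := 1) (x := x) (by simp)
    rwa [map_one, div_one, eval_one, div_one] at this
  rw [finiteValue, finiteValue, hcomp x _ h]

theorem finiteValue_sub_algebraMap (F : Mero p) (β x : ℂ_[p]) :
    finiteValue (F - algebraMap ℂ_[p] (Mero p) β) =ᶠ[𝓝[≠] x] fun z => finiteValue F z - β := by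
  obtain ⟨U, V, hV, rfl⟩ := exists_eq_div F
  have h : algebraMap (Entire p) (Mero p) U / algebraMap (Entire p) (Mero p) V -
      algebraMap ℂ_[p] (Mero p) β =
      algebraMap (Entire p) (Mero p) (U - algebraMap ℂ_[p] (Entire p) β * V) /
        algebraMap (Entire p) (Mero p) V := by
    rw [IsScalarTower.algebraMap_apply ℂ_[p] (Entire p) (Mero p), map_sub, map_mul, sub_div,
      mul_div_cancel_right₀ _ (algebraMap_ne_zero hV)]
  rw [h]
  filter_upwards [eventually_eval_ne_zero hV x] with z hz
  rw [finiteValue_eq_div hV (Or.inr hz), finiteValue_eq_div hV (Or.inr hz), eval_sub, eval_mul,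
    eval_algebraMap]
  field_simp

theorem exists_eq_xSub_sq_mul {f : Entire p} {b : ℂ_[p]} (h0 : eval f b = 0)
    (h1 : eval (der f) b = 0) : ∃ q, f = xSub b ^ 2 * q := by
  obtain ⟨q, rfl⟩ := exists_eq_xSub_mul h0
  rw [der_mul, der_xSub] at h1
  obtain ⟨q', rfl⟩ := exists_eq_xSub_mul (f := q) (z := b) (by simpa [eval_add, eval_mul] using h1)
  exact ⟨q', by ring⟩

/-- `G - b` is divisible by `z - x`, so a double zero at `b` pulls back to a zero of order at least
two at `x`, whatever the multiplicity of `G - b` there. -/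
theorem exists_analyticAt_of_comp {G q w : Entire p} {b x : ℂ_[p]} (hx : eval G x = b)
    (hw : eval w b ≠ 0) : ∃ k : ℂ_[p] → ℂ_[p], AnalyticAt ℂ_[p] k x ∧ ∀ z,
      (z - x) ^ 2 * k z = (eval G z - b) ^ 2 * eval q (eval G z) / eval w (eval G z) := by
  obtain ⟨s, hs⟩ := exists_eq_xSub_mul (f := G - algebraMap ℂ_[p] (Entire p) b) (z := x)
    (by rw [eval_sub, eval_algebraMap, hx, sub_self])
  have hs' : ∀ z, eval G z - b = (z - x) * eval s z := fun z => by
    simpa [eval_sub, eval_mul, eval_algebraMap] using congrArg (eval · z) hs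
  refine ⟨fun z => eval s z ^ 2 * eval q (eval G z) / eval w (eval G z), ?_, fun z => ?_⟩
  · have hG := analyticAt G x
    have h1 : AnalyticAt ℂ_[p] (fun z => eval q (eval G z)) x := (analyticAt q _).comp hG
    have h2 : AnalyticAt ℂ_[p] (fun z => eval w (eval G z)) x := (analyticAt w _).comp hG
    exact (((analyticAt s x).pow 2).mul h1).div h2 (by rwa [hx])
  · rw [hs' z]; ring

theorem isPseudoPrime_of_finite {F : Mero p} (hF : F.IsTranscendental)
    (hpoles : {x : ℂ_[p] | F.IsPole x ∧ ¬ F.IsSimplePole x}.Finite)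
    (hzeros : ∀ β : ℂ_[p], {x : ℂ_[p] | (F - algebraMap ℂ_[p] (Mero p) β).IsZero x ∧
        ¬ (F - algebraMap ℂ_[p] (Mero p) β).IsSimpleZero x}.Finite) :
    F.IsPseudoPrime := by
  intro f g hcomp
  by_contra! hcon
  obtain ⟨hf, hg⟩ := hcon
  obtain ⟨G, rfl⟩ := hcomp.exists_entire hF.ne_zero hf
  obtain ⟨u₀, v₀, hv₀, rfl⟩ := exists_eq_div f
  -- A ramification point of `f`: the Wronskian vanishes at `b` for every representing pair, in
  -- particular the reduced one.
  obtain ⟨b, hb⟩ : ∃ b, ∀ d u v : Entire p, u₀ = d * u → v₀ = d * v →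
      eval (wronskian u v) b = 0 := by
    by_contra! hcon
    obtain ⟨P, Q, hQ, hPQ⟩ := exists_polynomial_of_unramified (u := u₀) hv₀ hcon
    exact hf (isRational_of_mul_eq hv₀ hQ hPQ)
  obtain ⟨m, u, v, hu, hv, hne⟩ := exists_eq_xSub_pow_mul_pair u₀ hv₀ b
  have hW := hb _ u v hu hv
  have hv0 : v ≠ 0 := by
    rintro rfl
    rw [mul_zero] at hv
    exact hv₀ hv
  rw [(div_eq_div_iff' (u' := u) hv₀ hv0).2 (by rw [hu, hv]; ring)] at hcomp
  have hinf : {x | eval G x = b}.Infinite := by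
    have := infinite_zeros (f := G - ofPolynomial (Polynomial.C b)) (fun P h => by
      refine hg ?_
      rw [show G = ofPolynomial (P + Polynomial.C b) by
        rw [← ofPolynomialHom_apply, map_add, ofPolynomialHom_apply, ofPolynomialHom_apply, ← h,
          sub_add_cancel]]
      exact isRational_ofPolynomial _)
    refine this.mono fun x hx => ?_
    have hx : eval (G - ofPolynomial (Polynomial.C b)) x = 0 := hx
    rwa [eval_sub, eval_ofPolynomial, Polynomial.eval_C, sub_eq_zero] at hx
  rw [wronskian, eval_sub, eval_mul, eval_mul] at hW
  have hcont : ∀ w : Entire p, ∀ x, eval G x = b → eval w b ≠ 0 →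
      ∀ᶠ z in 𝓝[≠] x, eval w (eval G z) ≠ 0 := fun w x hx hw =>
    (((continuous w).comp (continuous G)).continuousAt.eventually_ne
      (by simpa [hx] using hw)).filter_mono nhdsWithin_le_nhds
  by_cases hvb : eval v b = 0
  · have hub := hne.resolve_right (not_not.2 hvb)
    rw [hvb, mul_zero, zero_sub, neg_eq_zero] at hW
    obtain ⟨q, hq⟩ := exists_eq_xSub_sq_mul hvb ((mul_eq_zero.1 hW).resolve_left hub)
    refine hinf (hpoles.subset fun x hx => ?_)
    obtain ⟨k, hk, hkeq⟩ := exists_analyticAt_of_comp (q := q) hx hub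
    -- A multiple pole is read off from the reciprocal `v(G) / u(G)`. The value 0 at poles agrees
    -- with division by zero, so the formula also holds where `v(G z) = 0`.
    have h2 : 2 ≤ meromorphicOrderAt (finiteValue F)⁻¹ x := by
      refine two_le_meromorphicOrderAt hk ?_
      filter_upwards [hcont u x hx hub] with z hz
      rw [Pi.inv_apply, finiteValue_comp hcomp, finiteValue_eq_div hv0 (Or.inl hz), hkeq, inv_div,
        hq, eval_mul, eval_pow, eval_xSub]
    rw [meromorphicOrderAt_inv] at h2
    -- Infinite order must be excluded, since the reciprocal would then have infinite order too and
    -- the bound would not give a pole.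
    have htop : meromorphicOrderAt (finiteValue F) x ≠ ⊤ := order_ne_top hF.ne_zero x
    change meromorphicOrderAt (finiteValue F) x < 0 ∧ ¬ meromorphicOrderAt (finiteValue F) x = -1
    lift meromorphicOrderAt (finiteValue F) x to ℤ using htop with n
    have h2' : (2 : ℤ) ≤ -n := WithTop.coe_le_coe.1 h2
    refine ⟨by exact_mod_cast (by omega : n < 0), fun h => ?_⟩
    have : n = -1 := WithTop.coe_injective h
    omega
  · set β := eval u b / eval v b with hβ
    obtain ⟨q, hq⟩ := exists_eq_xSub_sq_mul (f := u - algebraMap ℂ_[p] (Entire p) β * v) (b := b)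
      (by rw [eval_sub, eval_mul, eval_algebraMap, hβ]; field_simp; ring)
      (by
        rw [der_sub, der_mul, der_algebraMap, zero_mul, zero_add, eval_sub, eval_mul,
          eval_algebraMap, hβ]
        field_simp
        linear_combination hW)
    refine hinf ((hzeros β).subset fun x hx => ?_)
    obtain ⟨k, hk, hkeq⟩ := exists_analyticAt_of_comp (q := q) hx hvb
    have h2 : 2 ≤ meromorphicOrderAt (finiteValue (F - algebraMap ℂ_[p] (Mero p) β)) x := by
      refine two_le_meromorphicOrderAt hk ?_
      filter_upwards [hcont v x hx hvb, finiteValue_sub_algebraMap F β x] with z hz hFz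
      have h3 := congrArg (eval · (eval G z)) hq
      simp only [eval_sub, eval_mul, eval_algebraMap, eval_pow, eval_xSub] at h3
      rw [hFz, finiteValue_comp hcomp, finiteValue_eq_div hv0 (Or.inr hz), hkeq, ← h3]
      field_simp
    change 0 < meromorphicOrderAt (finiteValue _) x ∧ ¬ meromorphicOrderAt (finiteValue _) x = 1
    refine ⟨lt_of_lt_of_le (by norm_num) h2, fun h => ?_⟩
    rw [h] at h2
    exact absurd h2 (by decide)

end Mero

end PadicMero

theorem theorem2p1 (p : ℕ) [Fact p.Prime] (F : PadicMero.Mero p)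
    (hF : F.IsTranscendental)
    (hpoles : {x : ℂ_[p] | F.IsPole x ∧ ¬ F.IsSimplePole x}.Finite)
    (hzeros : ∀ β : ℂ_[p],
      {x : ℂ_[p] | (F - algebraMap ℂ_[p] (PadicMero.Mero p) β).IsZero x ∧
        ¬ (F - algebraMap ℂ_[p] (PadicMero.Mero p) β).IsSimpleZero x}.Finite) :
    F.IsPseudoPrime :=
  PadicMero.Mero.isPseudoPrime_of_finite hF hpoles hzeros
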